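/- Let $\Phi,\Psi:\mathbb R\to\mathbb R$ be bounded (measurable) functions with supports in $[-1,1]$, and let $\alpha,\beta\in\mathbb R$. For $\varepsilon,\nu>0$ consider in $L_2(\mathbb R)$ the Schrödinger operators $$S_{\varepsilon\nu}=-\frac{d^2}{dx^2}+\frac{\alpha}{\varepsilon^2}\,\Phi\!\left(\frac x\varepsilon\right)+\frac{\beta}{\nu}\,\Psi\!\left(\frac x\nu\right),\qquad \operatorname{dom}S_{\varepsilon\nu}=W_2^2(\mathbb R).$$ For real $\gamma_1\neq0$ and $\gamma_2$ let $S(\gamma_1,\gamma_2)$ be the operator acting by $\phi\mapsto-\phi''$ on the functions $\phi\in W_2^2(\mathbb R\setminus\{0\})$ such that $\phi(+0)=\gamma_1\phi(-0)$ and $\phi'(+0)=\gamma_1^{-1}\phi'(-0)+\gamma_2\phi(-0)$. Suppose that $\alpha$ is resonant for $\Phi$, i.e. that the equation $-u''+\alpha\Phi u=0$ has a nontrivial bounded solution on $\mathbb R$ (a half-bound state). Then there is exactly one half-bound state $u_\alpha$ with $u_\alpha(x)=1$ for all $x\le-1$. Put $$\theta_\alpha=\frac{u_\alpha(1)}{u_\alpha(-1)},\qquad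 \mu_\alpha=\theta_\alpha^{-1}\,u_\alpha(0)^2\int_{\mathbb R}\Psi\,dt .$$ Then $\theta_\alpha\ne0$, and $S_{\varepsilon\nu}$ converges to $S(\theta_\alpha,\beta\mu_\alpha)$ in the norm resolvent sense as $\varepsilon\to0$ and $\nu/\varepsilon\to0$: every $z\in\mathbb C\setminus\mathbb R$ belongs to the resolvent sets of $S(\theta_\alpha,\beta\mu_\alpha)$ and of all $S_{\varepsilon\nu}$ with $\varepsilon,\nu>0$, and $$\bigl\|(S_{\varepsilon\nu}-z)^{-1}-(S(\theta_\alpha,\beta\mu_\alpha)-z)^{-1}\bigr\|\to0\quad\text{as }\varepsilon\to0,\ \nu/\varepsilon\to0 .$$ Moreover the rate is $O(\varepsilon^{1/2}+\nu/\varepsilon)$: for every $z\in\mathbb C\setminus\mathbb R$ there are $C,\delta>0$, independent of $\varepsilon$ and $\nu$, such that the norm above is at most $C(\varepsilon^{1/2}+\nu/\varepsilon)$ whenever $0<\varepsilon<\delta$, $\nu>0$ and $\nu/\varepsilon<\delta$. -/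

import Mathlib

open Set Filter Topology MeasureTheory

noncomputable section

/-- The Hilbert space of square-integrable complex functions on the line. -/
abbrev L2R : Type := Lp ℂ 2 (volume : Measure ℝ)

/-! ### Sobolev functions of order two -/

/-- `IsW22 Ω φ φ₁ φ₂`: on the open set `Ω`, the function `φ` is continuously differentiable with
derivative `φ₁`, the function `φ₁` is locally absolutely continuous with derivative `φ₂`, and
`φ`, `φ₁`, `φ₂` are square-integrable on `Ω`. Thus `φ` is the `C¹` representative of an element
of the Sobolev space `W₂²(Ω)` whose weak derivatives are `φ₁` and `φ₂`. -/
structure IsW22 (Ω : Set ℝ) (φ φ₁ φ₂ : ℝ → ℂ) : Prop where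
  memLp : MemLp φ 2 (volume.restrict Ω)
  memLp_one : MemLp φ₁ 2 (volume.restrict Ω)
  memLp_two : MemLp φ₂ 2 (volume.restrict Ω)
  hasDerivAt : ∀ x ∈ Ω, HasDerivAt φ (φ₁ x) x
  sub_eq_integral : ∀ a b : ℝ, uIcc a b ⊆ Ω → φ₁ b - φ₁ a = ∫ x in a..b, φ₂ x

namespace IsW22

variable {Ω : Set ℝ} {φ φ₁ φ₂ ψ ψ₁ ψ₂ : ℝ → ℂ}

theorem intervalIntegrable_two (h : IsW22 Ω φ φ₁ φ₂) {a b : ℝ} (hab : uIcc a b ⊆ Ω) :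
    IntervalIntegrable φ₂ volume a b := by
  rw [intervalIntegrable_iff']
  have h1 : MemLp φ₂ 2 (volume.restrict (uIcc a b)) :=
    h.memLp_two.mono_measure (Measure.restrict_mono hab le_rfl)
  have : IsFiniteMeasure (volume.restrict (uIcc a b)) := ⟨by simp⟩
  exact h1.integrable (by norm_num)

theorem zero (Ω : Set ℝ) : IsW22 Ω 0 0 0 where
  memLp := MemLp.zero
  memLp_one := MemLp.zero
  memLp_two := MemLp.zero
  hasDerivAt x _ := hasDerivAt_const x (0 : ℂ)
  sub_eq_integral a b _ := by simp

theorem add (h : IsW22 Ω φ φ₁ φ₂) (k : IsW22 Ω ψ ψ₁ ψ₂) :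
    IsW22 Ω (φ + ψ) (φ₁ + ψ₁) (φ₂ + ψ₂) where
  memLp := h.memLp.add k.memLp
  memLp_one := h.memLp_one.add k.memLp_one
  memLp_two := h.memLp_two.add k.memLp_two
  hasDerivAt x hx := (h.hasDerivAt x hx).add (k.hasDerivAt x hx)
  sub_eq_integral a b hab := by
    simp only [Pi.add_apply]
    rw [intervalIntegral.integral_add (h.intervalIntegrable_two hab)
      (k.intervalIntegrable_two hab), ← h.sub_eq_integral a b hab, ← k.sub_eq_integral a b hab]
    ring

theorem smul (c : ℂ) (h : IsW22 Ω φ φ₁ φ₂) : IsW22 Ω (c • φ) (c • φ₁) (c • φ₂) where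
  memLp := h.memLp.const_smul c
  memLp_one := h.memLp_one.const_smul c
  memLp_two := h.memLp_two.const_smul c
  hasDerivAt x hx := (h.hasDerivAt x hx).const_smul c
  sub_eq_integral a b hab := by
    simp only [Pi.smul_apply]
    rw [intervalIntegral.integral_smul, ← h.sub_eq_integral a b hab, smul_sub]

/-- The second derivative of a Sobolev function that vanishes almost everywhere vanishes almost
everywhere. -/
theorem two_ae_eq_zero (hΩ : IsOpen Ω) (h : IsW22 Ω φ φ₁ φ₂)
    (h0 : φ =ᵐ[volume.restrict Ω] 0) : φ₂ =ᵐ[volume.restrict Ω] 0 := by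
  have hφ : EqOn φ 0 Ω := Measure.eqOn_open_of_ae_eq h0 hΩ
    (fun x hx => (h.hasDerivAt x hx).continuousAt.continuousWithinAt) continuousOn_const
  have hφ₁ : ∀ x ∈ Ω, φ₁ x = 0 := by
    intro x hx
    refine (h.hasDerivAt x hx).unique ((hasDerivAt_const x (0 : ℂ)).congr_of_eventuallyEq ?_)
    filter_upwards [hΩ.mem_nhds hx] with y hy using hφ hy
  have hg : LocallyIntegrable (Ω.indicator φ₂) volume :=
    ((memLp_indicator_iff_restrict hΩ.measurableSet).2 h.memLp_two).locallyIntegrable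
      (by norm_num)
  refine (ae_restrict_iff' hΩ.measurableSet).2 ?_
  filter_upwards [LocallyIntegrable.ae_hasDerivAt_integral hg] with x hx hxΩ
  have h1 := hx x
  rw [indicator_of_mem hxΩ] at h1
  refine h1.unique ((hasDerivAt_const x (0 : ℂ)).congr_of_eventuallyEq ?_)
  obtain ⟨r, hr, hball⟩ := Metric.isOpen_iff.1 hΩ x hxΩ
  filter_upwards [Metric.ball_mem_nhds x hr] with y hy
  have hsub : uIcc x y ⊆ Ω := by
    refine subset_trans ?_ hball
    have : (Metric.ball x r).OrdConnected := by
      rw [Real.ball_eq_Ioo]; exact ordConnected_Ioo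
    exact this.uIcc_subset (Metric.mem_ball_self hr) hy
  have hcongr : ∫ t in x..y, Ω.indicator φ₂ t = ∫ t in x..y, φ₂ t :=
    intervalIntegral.integral_congr fun t ht => indicator_of_mem (hsub ht) _
  rw [hcongr, ← h.sub_eq_integral x y hsub, hφ₁ x hxΩ, hφ₁ y (hsub right_mem_uIcc), sub_zero]

end IsW22

/-! ### The operators -/

/-- The graph of `-d²/dx² + V` with domain `W₂²(ℝ)`: the pairs of classes of `φ` and
`-φ'' + V φ`. (For bounded `V`, the second entry is in `L²` for every `φ` in `W₂²(ℝ)`.) -/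
def schrodingerGraph (V : ℝ → ℝ) : Submodule ℂ (L2R × L2R) where
  carrier := {p | ∃ φ φ₁ φ₂ : ℝ → ℂ, IsW22 univ φ φ₁ φ₂ ∧ p.1 =ᵐ[volume] φ ∧
    p.2 =ᵐ[volume] fun x => -φ₂ x + (V x : ℂ) * φ x}
  zero_mem' := by
    refine ⟨0, 0, 0, IsW22.zero _, Lp.coeFn_zero _ _ _, ?_⟩
    filter_upwards [Lp.coeFn_zero ℂ 2 (volume : Measure ℝ)] with x hx
    simp
  add_mem' := by
    rintro p q ⟨φ, φ₁, φ₂, h, hp1, hp2⟩ ⟨ψ, ψ₁, ψ₂, k, hq1, hq2⟩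
    refine ⟨φ + ψ, φ₁ + ψ₁, φ₂ + ψ₂, h.add k, ?_, ?_⟩
    · filter_upwards [Lp.coeFn_add p.1 q.1, hp1, hq1] with x hx h1 h2
      simp only [Prod.fst_add, hx, Pi.add_apply, h1, h2]
    · filter_upwards [Lp.coeFn_add p.2 q.2, hp2, hq2] with x hx h1 h2
      simp only [Prod.snd_add, hx, Pi.add_apply, h1, h2]
      ring
  smul_mem' := by
    rintro c p ⟨φ, φ₁, φ₂, h, hp1, hp2⟩
    refine ⟨c • φ, c • φ₁, c • φ₂, h.smul c, ?_, ?_⟩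
    · filter_upwards [Lp.coeFn_smul c p.1, hp1] with x hx h1
      simp [hx, h1]
    · filter_upwards [Lp.coeFn_smul c p.2, hp2] with x hx h1
      simp only [Prod.smul_snd, hx, Pi.smul_apply, h1, smul_eq_mul]
      ring

/-- The Schrödinger operator `-d²/dx² + V` in `L²(ℝ)` with domain `W₂²(ℝ)`. -/
def schrodinger (V : ℝ → ℝ) : L2R →ₗ.[ℂ] L2R := (schrodingerGraph V).toLinearPMap

theorem schrodingerGraph_functional (V : ℝ → ℝ) (p : L2R × L2R) (hp : p ∈ schrodingerGraph V)
    (h0 : p.1 = 0) : p.2 = 0 := by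
  obtain ⟨φ, φ₁, φ₂, h, hp1, hp2⟩ := hp
  have hz : φ =ᵐ[volume] 0 := by
    rw [h0] at hp1
    exact hp1.symm.trans (Lp.coeFn_zero _ _ _)
  have h2 := h.two_ae_eq_zero isOpen_univ (by simpa using hz)
  rw [Measure.restrict_univ] at h2
  refine Lp.ext ?_
  filter_upwards [hp2, hz, h2, Lp.coeFn_zero ℂ 2 (volume : Measure ℝ)] with x a b c d
  simp [a, b, c]

theorem schrodinger_graph (V : ℝ → ℝ) : (schrodinger V).graph = schrodingerGraph V :=
  Submodule.toLinearPMap_graph_eq _ fun p hp h0 => schrodingerGraph_functional V p hp h0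

/-- The graph of the point interaction `S(γ₁, γ₂)`: the pairs of classes of `φ` and `-φ''`, where
`φ` is in `W₂²(ℝ ∖ {0})`, `φ(+0) = γ₁ φ(-0)` and `φ'(+0) = γ₁⁻¹ φ'(-0) + γ₂ φ(-0)`. Here `l` and
`m` are `φ(-0)` and `φ'(-0)`. -/
def pointInteractionGraph (γ₁ γ₂ : ℝ) : Submodule ℂ (L2R × L2R) where
  carrier := {p | ∃ φ φ₁ φ₂ : ℝ → ℂ, IsW22 {0}ᶜ φ φ₁ φ₂ ∧
    (∃ l m : ℂ, Tendsto φ (𝓝[<] 0) (𝓝 l) ∧ Tendsto φ₁ (𝓝[<] 0) (𝓝 m) ∧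
      Tendsto φ (𝓝[>] 0) (𝓝 ((γ₁ : ℂ) * l)) ∧
      Tendsto φ₁ (𝓝[>] 0) (𝓝 ((γ₁ : ℂ)⁻¹ * m + (γ₂ : ℂ) * l))) ∧
    p.1 =ᵐ[volume] φ ∧ p.2 =ᵐ[volume] fun x => -φ₂ x}
  zero_mem' := by
    refine ⟨0, 0, 0, IsW22.zero _, ⟨0, 0, ?_, ?_, ?_, ?_⟩, Lp.coeFn_zero _ _ _, ?_⟩
    · exact tendsto_const_nhds
    · exact tendsto_const_nhds
    · simp only [mul_zero]; exact tendsto_const_nhds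
    · simp only [mul_zero, add_zero]; exact tendsto_const_nhds
    · filter_upwards [Lp.coeFn_zero ℂ 2 (volume : Measure ℝ)] with x hx
      simp
  add_mem' := by
    rintro p q ⟨φ, φ₁, φ₂, h, ⟨l, m, a1, a2, a3, a4⟩, hp1, hp2⟩
      ⟨ψ, ψ₁, ψ₂, k, ⟨l', m', b1, b2, b3, b4⟩, hq1, hq2⟩
    refine ⟨φ + ψ, φ₁ + ψ₁, φ₂ + ψ₂, h.add k,
      ⟨l + l', m + m', a1.add b1, a2.add b2, ?_, ?_⟩, ?_, ?_⟩
    · rw [mul_add]; exact a3.add b3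
    · convert! a4.add b4 using 2
      ring
    · filter_upwards [Lp.coeFn_add p.1 q.1, hp1, hq1] with x hx h1 h2
      simp only [Prod.fst_add, hx, Pi.add_apply, h1, h2]
    · filter_upwards [Lp.coeFn_add p.2 q.2, hp2, hq2] with x hx h1 h2
      simp only [Prod.snd_add, hx, Pi.add_apply, h1, h2]
      ring
  smul_mem' := by
    rintro c p ⟨φ, φ₁, φ₂, h, ⟨l, m, a1, a2, a3, a4⟩, hp1, hp2⟩
    refine ⟨c • φ, c • φ₁, c • φ₂, h.smul c,
      ⟨c • l, c • m, a1.const_smul c, a2.const_smul c, ?_, ?_⟩, ?_, ?_⟩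
    · convert! a3.const_smul c using 2
      simp only [smul_eq_mul]; ring
    · convert! a4.const_smul c using 2
      simp only [smul_eq_mul]; ring
    · filter_upwards [Lp.coeFn_smul c p.1, hp1] with x hx h1
      simp [hx, h1]
    · filter_upwards [Lp.coeFn_smul c p.2, hp2] with x hx h1
      simp only [Prod.smul_snd, hx, Pi.smul_apply, h1, smul_eq_mul]
      ring

/-- The point interaction `S(γ₁, γ₂)` at the origin. -/
def pointInteraction (γ₁ γ₂ : ℝ) : L2R →ₗ.[ℂ] L2R := (pointInteractionGraph γ₁ γ₂).toLinearPMap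

theorem pointInteractionGraph_functional (γ₁ γ₂ : ℝ) (p : L2R × L2R)
    (hp : p ∈ pointInteractionGraph γ₁ γ₂) (h0 : p.1 = 0) : p.2 = 0 := by
  obtain ⟨φ, φ₁, φ₂, h, -, hp1, hp2⟩ := hp
  have hz : φ =ᵐ[volume] 0 := by
    rw [h0] at hp1
    exact hp1.symm.trans (Lp.coeFn_zero _ _ _)
  have h2 := h.two_ae_eq_zero isOpen_compl_singleton (ae_restrict_of_ae hz)
  have hr : (volume : Measure ℝ).restrict {0}ᶜ = volume :=
    Measure.restrict_eq_self_of_ae_mem (compl_mem_ae_iff.2 (measure_singleton 0))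
  rw [hr] at h2
  refine Lp.ext ?_
  filter_upwards [hp2, h2, Lp.coeFn_zero ℂ 2 (volume : Measure ℝ)] with x a c d
  simp [a, c]

theorem pointInteraction_graph (γ₁ γ₂ : ℝ) :
    (pointInteraction γ₁ γ₂).graph = pointInteractionGraph γ₁ γ₂ :=
  Submodule.toLinearPMap_graph_eq _ fun p hp h0 => pointInteractionGraph_functional γ₁ γ₂ p hp h0

/-- `R` is the resolvent `(A - z)⁻¹`, an everywhere defined bounded operator; that is, `z` is in
the resolvent set of `A`, and `R` is a two-sided inverse of `A - z : dom A → L²(ℝ)`. -/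
def IsResolvent (A : L2R →ₗ.[ℂ] L2R) (z : ℂ) (R : L2R →L[ℂ] L2R) : Prop :=
  (∀ f : L2R, ∃ h : R f ∈ A.domain, A ⟨R f, h⟩ - z • R f = f) ∧
    ∀ y : A.domain, R (A y - z • (y : L2R)) = y

/-! ### Potentials and half-bound states -/

/-- The class of bounded real (measurable) functions with support in `[-1, 1]`. -/
structure IsPotential (Φ : ℝ → ℝ) : Prop where
  aemeasurable : AEMeasurable Φ volume
  bounded : ∃ M : ℝ, ∀ t, |Φ t| ≤ M
  support_subset : Function.support Φ ⊆ Icc (-1) 1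

/-- The potential `α ε⁻² Φ(x/ε) + β ν⁻¹ Ψ(x/ν)`. -/
def scaledPotential (Φ Ψ : ℝ → ℝ) (α β ε ν : ℝ) (x : ℝ) : ℝ :=
  α / ε ^ 2 * Φ (x / ε) + β / ν * Ψ (x / ν)

/-- `u` is a half-bound state of `-d²/dt² + α Φ`: a nontrivial bounded solution of
`-u'' + α Φ u = 0` on the line, i.e. `u` is `C¹` with locally absolutely continuous derivative,
and the equation holds almost everywhere. -/
structure IsHalfBoundState (Φ : ℝ → ℝ) (α : ℝ) (u : ℝ → ℝ) : Prop where
  solution : ∃ u₁ : ℝ → ℝ, (∀ t, HasDerivAt u (u₁ t) t) ∧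
    ∀ a b, u₁ b - u₁ a = ∫ t in a..b, α * Φ t * u t
  bounded : ∃ M : ℝ, ∀ t, |u t| ≤ M
  nontrivial : u ≠ 0

/-- The resonant set of `Φ`. -/
def resonantSet (Φ : ℝ → ℝ) : Set ℝ := {α | ∃ u, IsHalfBoundState Φ α u}

/-- A half-bound state normalized by `u = 1` on `(-∞, -1]`. -/
def IsNormalizedHalfBoundState (Φ : ℝ → ℝ) (α : ℝ) (u : ℝ → ℝ) : Prop :=
  IsHalfBoundState Φ α u ∧ ∀ t ≤ -1, u t = 1

/-- `θ = u(1) / u(-1)`, where `u` is a half-bound state. -/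
def theta (u : ℝ → ℝ) : ℝ := u 1 / u (-1)

/-- `μ = θ⁻¹ u(0)² ∫ Ψ`, where `u` is the normalized half-bound state. -/
def mu (Ψ u : ℝ → ℝ) : ℝ := (theta u)⁻¹ * u 0 ^ 2 * ∫ t, Ψ t

/-- For pairs `(ε, ν)` of positive numbers: `ε → 0` and `ν / ε → 0`. -/
def fastContraction : Filter (ℝ × ℝ) :=
  comap (fun p : ℝ × ℝ => (p.1, p.2 / p.1)) (𝓝[>] 0 ×ˢ 𝓝[>] 0)

end

/-! Let ψ and χ be the images of one f under the two resolvents. Symmetry bounds both L² norms by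
|Im z|⁻¹‖f‖. Outside [-ε, ε] the potential vanishes, so d = ψ - χ satisfies d'' = -z d there. Taking
imaginary parts of ∫ d'' d̄ expresses Im z times the squared exterior norm of d through the Cauchy
data at ±ε. The limiting interface conditions are symmetric, so these boundary terms contain only
the defects d(ε) - θ d(-ε) and θ d'(ε) - d'(-ε) - κ d(-ε), where κ = θβμ = β u(0)² ∫Ψ, each
multiplied by a boundary value that the exterior norm controls. Hence the exterior norm is linear in
the defects (`IsW22.exterior_le`). Inside, ψ and χ are bounded by a multiple of ‖f‖ on an interval
of length 2ε, which contributes O(√ε).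

The defects are estimated separately. For χ the conditions hold exactly at 0±, and moving to ±ε
costs O(ε) for the function and O(√ε) for the derivative (`pointInteraction_transfer`). For ψ put
v(t) = ψ(εt) and η = ν/ε. Then v'' = (αΦ + ε q) v + r on [-1, 1], where q = β η⁻¹Ψ(·/η) - εz is
bounded in L¹, v'(-1) = O(ε) and r is of order ε^{3/2} in L¹. Grönwall gives v = v(-1) u + O(ε)
(`IsRescaledSolution.norm_sub_le`). Since u' vanishes at ±1, the Wronskian of v and u turns θ v'(1)
- v'(-1) into ε ∫ q v u + ∫ r u; the spike samples u² near 0, so this is εβ u(0)² (∫Ψ) v(-1) up to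
O(ε(√ε + η)) (`IsRescaledSolution.transfer`). Dividing by ε, because v' = ε ψ', gives the rate.

Resolvents exist because symmetry gives |Im z| ‖p‖ ≤ ‖(A - z) p‖, which leaves surjectivity. The
free equation is solved by splitting it into first order equations, a bounded potential is switched
on in small steps, and interface conditions are met by adding decaying exponentials. A half-bound
state is affine and bounded, hence constant, on each side of [-1, 1], and it is determined by its
value at -1. -/

open scoped ComplexConjugate InnerProductSpace Convolution

/-! ### Absolutely continuous complex functions -/

/-- A primitive of a complex integrable function is absolutely continuous. -/
theorem MeasureTheory.Integrable.absolutelyContinuousOnInterval_primitive {f : ℝ → ℂ}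
    (h : Integrable f) (a b : ℝ) :
    AbsolutelyContinuousOnInterval (fun x => ∫ v in a..x, f v) a b := by
  have h1 := (h.re.intervalIntegrable (a := a) (b := b)
    ).absolutelyContinuousOnInterval_intervalIntegral (c := a) left_mem_uIcc
  have h2 := (h.im.intervalIntegrable (a := a) (b := b)
    ).absolutelyContinuousOnInterval_intervalIntegral (c := a) left_mem_uIcc
  have hc (c : ℂ) : AbsolutelyContinuousOnInterval (fun _ : ℝ => c) a b :=
    (LipschitzWith.const c).lipschitzOnWith.absolutelyContinuousOnInterval
  convert! (h1.fun_smul (hc 1)).fun_add (h2.fun_smul (hc Complex.I)) using 2 with x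
  have e1 := Complex.reCLM.intervalIntegral_comp_comm (h.intervalIntegrable (a := a) (b := x))
  have e2 := Complex.imCLM.intervalIntegral_comp_comm (h.intervalIntegrable (a := a) (b := x))
  simp only [Complex.reCLM_apply, Complex.imCLM_apply] at e1 e2
  simp only [RCLike.re_to_complex, RCLike.im_to_complex, e1, e2, Complex.real_smul, mul_one,
    Complex.re_add_im]

/-- Integration by parts for primitives of integrable functions. -/
theorem mul_sub_mul_eq_integral_of_primitive {F G f g : ℝ → ℂ} {a b : ℝ}
    (hf : IntervalIntegrable f volume a b) (hg : IntervalIntegrable g volume a b)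
    (hF : ∀ x ∈ uIcc a b, F x - F a = ∫ t in a..x, f t)
    (hG : ∀ x ∈ uIcc a b, G x - G a = ∫ t in a..x, g t) :
    F b * G b - F a * G a = ∫ x in a..b, (f x * G x + F x * g x) := by
  -- Integrability is known only between a and b. Truncation yields global primitives P and Q that
  -- agree with F and G there.
  set f' := (uIoc a b).indicator f with hf'
  set g' := (uIoc a b).indicator g with hg'
  have hfi : Integrable f' := (integrable_indicator_iff measurableSet_uIoc).2 hf.def'
  have hgi : Integrable g' := (integrable_indicator_iff measurableSet_uIoc).2 hg.def'
  have hcongr (k : ℝ → ℂ) : ∀ x ∈ uIcc a b,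
      ∫ t in a..x, (uIoc a b).indicator k t = ∫ t in a..x, k t := fun x hx =>
    intervalIntegral.integral_congr_ae (Eventually.of_forall fun t ht =>
      indicator_of_mem ((by grind [uIoc, uIcc])) _)
  set P : ℝ → ℂ := fun x => F a + ∫ t in a..x, f' t with hP
  set Q : ℝ → ℂ := fun x => G a + ∫ t in a..x, g' t with hQ
  have hPF : ∀ x ∈ uIcc a b, P x = F x := fun x hx => by
    rw [hP]; simp only; rw [hcongr f x hx, ← hF x hx]; ring
  have hQG : ∀ x ∈ uIcc a b, Q x = G x := fun x hx => by
    rw [hQ]; simp only; rw [hcongr g x hx, ← hG x hx]; ring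
  have hc (c : ℂ) : AbsolutelyContinuousOnInterval (fun _ : ℝ => c) a b :=
    (LipschitzWith.const c).lipschitzOnWith.absolutelyContinuousOnInterval
  have hPac : AbsolutelyContinuousOnInterval P a b :=
    (hc _).fun_add (hfi.absolutelyContinuousOnInterval_primitive a b)
  have hQac : AbsolutelyContinuousOnInterval Q a b :=
    (hc _).fun_add (hgi.absolutelyContinuousOnInterval_primitive a b)
  have hPcont : Continuous P :=
    continuous_const.add (intervalIntegral.continuous_primitive (fun _ _ =>
      hfi.intervalIntegrable) a)
  have hQcont : Continuous Q :=
    continuous_const.add (intervalIntegral.continuous_primitive (fun _ _ =>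
      hgi.intervalIntegrable) a)
  have hloc : LocallyIntegrable (fun x => f' x * Q x + P x * g' x) volume :=
    (hfi.locallyIntegrable.mul_continuous hQcont).add
      (hgi.locallyIntegrable.continuous_mul hPcont)
  have hprod : Integrable ((uIoc a b).indicator fun x => f' x * Q x + P x * g' x) :=
    (integrable_indicator_iff measurableSet_uIoc).2
      ((hloc.integrableOn_isCompact isCompact_uIcc).mono_set uIoc_subset_uIcc)
  -- PQ minus the primitive of its expected derivative is absolutely continuous with zero derivative
  -- almost everywhere, hence constant. The point min a b is discarded because the truncation to the
  -- half-open interval omits it.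
  have hac := (hPac.fun_smul hQac).fun_sub (hprod.absolutelyContinuousOnInterval_primitive a b)
  obtain ⟨C, hC⟩ := hac.const_of_ae_hasDerivAt_zero (by
    filter_upwards [LocallyIntegrable.ae_hasDerivAt_integral hfi.locallyIntegrable,
      LocallyIntegrable.ae_hasDerivAt_integral hgi.locallyIntegrable,
      LocallyIntegrable.ae_hasDerivAt_integral hprod.locallyIntegrable,
      compl_mem_ae_iff.2 (measure_singleton (min a b))] with x h1 h2 h3 h4 hx
    have hx' : x ∈ uIoc a b := by
      rw [uIcc, mem_Icc] at hx
      exact ⟨lt_of_le_of_ne hx.1 (fun h => h4 h.symm), hx.2⟩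
    have := ((h1 a).const_add (F a)).mul ((h2 a).const_add (G a))
    have h5 := this.sub (h3 a)
    rw [indicator_of_mem hx'] at h5
    convert! h5 using 1
    simp only [hP, hQ]; ring)
  have h1 := hC a left_mem_uIcc
  have h2 := hC b right_mem_uIcc
  simp only [intervalIntegral.integral_same, sub_zero, smul_eq_mul] at h1 h2
  rw [← h1, hPF b right_mem_uIcc, hQG b right_mem_uIcc, hPF a left_mem_uIcc,
    hQG a left_mem_uIcc, hcongr _ b right_mem_uIcc, sub_eq_iff_eq_add, add_comm,
    ← sub_eq_iff_eq_add] at h2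
  rw [h2]
  refine intervalIntegral.integral_congr_ae (Eventually.of_forall fun t ht => ?_)
  simp only [hf', hg', indicator_of_mem ht, hPF t (uIoc_subset_uIcc ht),
    hQG t (uIoc_subset_uIcc ht)]

/-! ### Square-integrable functions on subsets of the line -/

theorem MeasureTheory.MemLp.lpNorm_mono_measure {f : ℝ → ℂ} {μ ν : Measure ℝ}
    (h : MemLp f 2 ν) (hμ : μ ≤ ν) : lpNorm f 2 μ ≤ lpNorm f 2 ν := by
  rw [← toReal_eLpNorm h.1, ← toReal_eLpNorm (h.mono_measure hμ).1]
  exact ENNReal.toReal_mono h.eLpNorm_ne_top (eLpNorm_mono_measure _ hμ)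

theorem lpNorm_two_sq {f : ℝ → ℂ} {μ : Measure ℝ} (h : MemLp f 2 μ) :
    lpNorm f 2 μ ^ 2 = ∫ x, ‖f x‖ ^ 2 ∂μ := by
  rw [lpNorm_eq_integral_norm_rpow_toReal (by norm_num) (by norm_num) h.1]
  simp only [ENNReal.toReal_ofNat, Real.rpow_ofNat]
  rw [← Real.rpow_natCast, ← Real.rpow_mul (integral_nonneg fun x => by positivity)]
  norm_num

theorem lpNorm_congr_ae' {f g : ℝ → ℂ} {μ : Measure ℝ} (h : f =ᵐ[μ] g) :
    lpNorm f 2 μ = lpNorm g 2 μ := by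
  by_cases hf : AEStronglyMeasurable f μ
  · rw [← toReal_eLpNorm hf, ← toReal_eLpNorm (hf.congr h), eLpNorm_congr_ae h]
  · rw [lpNorm_of_not_aestronglyMeasurable hf,
      lpNorm_of_not_aestronglyMeasurable (fun hg => hf (hg.congr h.symm))]

theorem L2R.norm_eq_lpNorm {p : L2R} {f : ℝ → ℂ} (h : p =ᵐ[volume] f) :
    ‖p‖ = lpNorm f 2 volume := by
  rw [Lp.norm_def, toReal_eLpNorm (Lp.aestronglyMeasurable p), lpNorm_congr_ae' h]

/-- The Cauchy-Schwarz inequality against the constant function on an interval. -/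
theorem integral_norm_le_sqrt_mul_lpNorm {f : ℝ → ℂ} {a b : ℝ} (hab : a ≤ b)
    (h : MemLp f 2 (volume.restrict (Ioc a b))) :
    ∫ x in a..b, ‖f x‖ ≤ √(b - a) * lpNorm f 2 (volume.restrict (Ioc a b)) := by
  rw [intervalIntegral.integral_of_le hab, ← lpNorm_one_eq_integral_norm h.1,
    ← toReal_eLpNorm h.1, ← toReal_eLpNorm h.1]
  have h1 := eLpNorm_le_eLpNorm_mul_rpow_measure_univ (p := 1) (q := 2) (by norm_num) h.1
  simp only [MeasurableSet.univ, Measure.restrict_apply, univ_inter, Real.volume_Ioc,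
    ENNReal.toReal_one, ENNReal.toReal_ofNat] at h1
  refine (ENNReal.toReal_mono (ENNReal.mul_ne_top h.eLpNorm_ne_top
    (ENNReal.rpow_ne_top_of_nonneg (by norm_num) (by simp))) h1).trans_eq ?_
  rw [ENNReal.toReal_mul, mul_comm, ← ENNReal.toReal_rpow,
    ENNReal.toReal_ofReal (sub_nonneg.2 hab), Real.sqrt_eq_rpow]
  norm_num

theorem MeasureTheory.MemLp.intervalIntegrable_of_two {f : ℝ → ℂ} {a b : ℝ} (hab : a ≤ b)
    (h : MemLp f 2 (volume.restrict (Ioc a b))) : IntervalIntegrable f volume a b := by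
  rw [intervalIntegrable_iff_integrableOn_Ioc_of_le hab]
  have : IsFiniteMeasure (volume.restrict (Ioc a b)) := ⟨by simp⟩
  exact h.integrable (by norm_num)

/-! ### Sobolev functions of order two -/

namespace IsW22

variable {Ω Ω' : Set ℝ} {φ φ₁ φ₂ ψ ψ₁ ψ₂ : ℝ → ℂ}

theorem mono (h : IsW22 Ω φ φ₁ φ₂) (hs : Ω' ⊆ Ω) : IsW22 Ω' φ φ₁ φ₂ where
  memLp := h.memLp.mono_measure (Measure.restrict_mono hs le_rfl)
  memLp_one := h.memLp_one.mono_measure (Measure.restrict_mono hs le_rfl)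
  memLp_two := h.memLp_two.mono_measure (Measure.restrict_mono hs le_rfl)
  hasDerivAt x hx := h.hasDerivAt x (hs hx)
  sub_eq_integral a b hab := h.sub_eq_integral a b (hab.trans hs)

theorem sub (h : IsW22 Ω φ φ₁ φ₂) (k : IsW22 Ω ψ ψ₁ ψ₂) :
    IsW22 Ω (φ - ψ) (φ₁ - ψ₁) (φ₂ - ψ₂) := by
  simpa [sub_eq_add_neg] using h.add (k.smul (-1))

theorem memLp_comp_neg {f : ℝ → ℂ} (h : MemLp f 2 (volume.restrict Ω)) :
    MemLp (fun x => f (-x)) 2 (volume.restrict (Neg.neg ⁻¹' Ω)) :=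
  h.comp_measurePreserving ((Measure.measurePreserving_neg volume).restrict_preimage_emb
    (Homeomorph.neg ℝ).measurableEmbedding Ω)

/-- Reflection of a Sobolev function. -/
theorem comp_neg (h : IsW22 Ω φ φ₁ φ₂) :
    IsW22 (Neg.neg ⁻¹' Ω) (fun x => φ (-x)) (fun x => -φ₁ (-x)) (fun x => φ₂ (-x)) where
  memLp := memLp_comp_neg h.memLp
  memLp_one := (memLp_comp_neg h.memLp_one).neg
  memLp_two := memLp_comp_neg h.memLp_two
  hasDerivAt x hx := by
    have := (h.hasDerivAt (-x) hx).scomp x (hasDerivAt_neg x)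
    simpa [Function.comp_def] using this
  sub_eq_integral a b hab := by
    have hab' : uIcc (-a) (-b) ⊆ Ω := by
      intro t ht
      have := hab (show -t ∈ uIcc a b by grind [uIcc])
      simpa using this
    rw [intervalIntegral.integral_comp_neg, intervalIntegral.integral_symm,
      ← h.sub_eq_integral _ _ hab']
    ring

theorem continuousOn_one (h : IsW22 Ω φ φ₁ φ₂) {a b : ℝ} (hab : uIcc a b ⊆ Ω) :
    ContinuousOn φ₁ (uIcc a b) := by
  have h1 : ContinuousOn (fun x => φ₁ a + ∫ t in a..x, φ₂ t) (uIcc a b) :=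
    continuousOn_const.add (intervalIntegral.continuousOn_primitive_interval
      (by
        have := (h.intervalIntegrable_two hab)
        rwa [intervalIntegrable_iff'] at this))
  refine h1.congr fun x hx => ?_
  simp only [← h.sub_eq_integral a x ((uIcc_subset_uIcc_left hx).trans hab)]
  ring

theorem continuousOn (h : IsW22 Ω φ φ₁ φ₂) : ContinuousOn φ Ω := fun x hx =>
  (h.hasDerivAt x hx).continuousAt.continuousWithinAt

theorem sub_eq_integral_one (h : IsW22 Ω φ φ₁ φ₂) {a b : ℝ} (hab : uIcc a b ⊆ Ω) :
    φ b - φ a = ∫ x in a..b, φ₁ x :=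
  (intervalIntegral.integral_eq_sub_of_hasDerivAt (fun x hx => h.hasDerivAt x (hab hx))
    (h.continuousOn_one hab).intervalIntegrable).symm

/-- Integration by parts of `φ₁` against a primitive. -/
theorem one_mul_sub (h : IsW22 Ω φ φ₁ φ₂) {a b : ℝ} (hab : uIcc a b ⊆ Ω) {G g : ℝ → ℂ}
    (hg : IntervalIntegrable g volume a b)
    (hG : ∀ x ∈ uIcc a b, G x - G a = ∫ t in a..x, g t) :
    φ₁ b * G b - φ₁ a * G a = ∫ x in a..b, (φ₂ x * G x + φ₁ x * g x) :=
  mul_sub_mul_eq_integral_of_primitive (h.intervalIntegrable_two hab) hg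
    (fun x hx => h.sub_eq_integral a x ((uIcc_subset_uIcc_left hx).trans hab)) hG

/-- The values of a Sobolev function and of its derivative at a point are controlled by the
`L²` norms of the function and of its second derivative on an adjacent interval of length one. -/
theorem norm_le (h : IsW22 Ω φ φ₁ φ₂) {c : ℝ} (hc : Icc c (c + 1) ⊆ Ω) :
    ‖φ c‖ ≤ 12 * (lpNorm φ 2 (volume.restrict (Ioc c (c + 1))) +
        lpNorm φ₂ 2 (volume.restrict (Ioc c (c + 1)))) ∧
      ‖φ₁ c‖ ≤ 12 * (lpNorm φ 2 (volume.restrict (Ioc c (c + 1))) +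
        lpNorm φ₂ 2 (volume.restrict (Ioc c (c + 1)))) := by
  have hcc : c ≤ c + 1 := by linarith
  have hu : uIcc c (c + 1) ⊆ Ω := by rwa [uIcc_of_le hcc]
  have hm := h.mono (Ioc_subset_Icc_self.trans hc)
  have i0 : ContinuousOn φ (uIcc c (c + 1)) := h.continuousOn.mono hu
  have i1 := h.continuousOn_one hu
  have i0' : IntervalIntegrable φ volume c (c + 1) := i0.intervalIntegrable
  have i1' : IntervalIntegrable φ₁ volume c (c + 1) := i1.intervalIntegrable
  have i2 := h.intervalIntegrable_two hu
  -- Two integrations by parts of φ₂ against a weight P with P = P' = 0 at c + 1 leave only boundary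
  -- values at c. No bound on φ₁ inside the interval is needed.
  have key (P P' P'' : ℝ → ℝ) (hP : ∀ x, HasDerivAt P (P' x) x)
      (hP' : ∀ x, HasDerivAt P' (P'' x) x) (hP'' : Continuous P'')
      (e0 : P (c + 1) = 0) (e1 : P' (c + 1) = 0)
      (bd : ∀ x ∈ Icc c (c + 1), |P x| ≤ 1) (bd'' : ∀ x ∈ Icc c (c + 1), |P'' x| ≤ 4) :
      ‖P c * φ₁ c - P' c * φ c‖ ≤ 4 * lpNorm φ 2 (volume.restrict (Ioc c (c + 1))) +
        lpNorm φ₂ 2 (volume.restrict (Ioc c (c + 1))) := by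
    have cP : Continuous P := continuous_iff_continuousAt.2 fun x => (hP x).continuousAt
    have cP' : Continuous P' := continuous_iff_continuousAt.2 fun x => (hP' x).continuousAt
    have cPc : Continuous fun x => (P x : ℂ) := by fun_prop
    have cPc' : Continuous fun x => (P' x : ℂ) := by fun_prop
    have cPc'' : Continuous fun x => (P'' x : ℂ) := by fun_prop
    have d1 (a b : ℝ) : (P b : ℂ) - P a = ∫ t in a..b, (P' t : ℂ) :=
      (intervalIntegral.integral_eq_sub_of_hasDerivAt (f := fun x => (P x : ℂ))
        (fun x _ => (hP x).ofReal_comp) (cPc'.intervalIntegrable _ _)).symm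
    have d2 (a b : ℝ) : (P' b : ℂ) - P' a = ∫ t in a..b, (P'' t : ℂ) :=
      (intervalIntegral.integral_eq_sub_of_hasDerivAt (f := fun x => (P' x : ℂ))
        (fun x _ => (hP' x).ofReal_comp) (cPc''.intervalIntegrable _ _)).symm
    have a1 := h.one_mul_sub hu (cPc'.intervalIntegrable c (c + 1)) (fun x _ => d1 c x)
    have a2 := mul_sub_mul_eq_integral_of_primitive i1'
      (cPc''.intervalIntegrable c (c + 1))
      (fun x hx => h.sub_eq_integral_one ((uIcc_subset_uIcc_left hx).trans hu))
      (fun x _ => d2 c x)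
    have j1 := i2.mul_continuousOn cPc.continuousOn
    have j2 := i1'.mul_continuousOn cPc'.continuousOn
    have j3 := i0'.mul_continuousOn cPc''.continuousOn
    rw [intervalIntegral.integral_add j1 j2, e0] at a1
    rw [intervalIntegral.integral_add j2 j3, e1] at a2
    have a3 : P c * φ₁ c - P' c * φ c =
        (∫ x in c..c + 1, φ x * P'' x) - ∫ x in c..c + 1, φ₂ x * P x := by
      push_cast at a1 a2
      linear_combination -a1 + a2
    rw [a3]
    refine (norm_sub_le _ _).trans (add_le_add ?_ ?_)
    · have hn := integral_norm_le_sqrt_mul_lpNorm hcc hm.memLp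
      rw [add_sub_cancel_left, Real.sqrt_one, one_mul] at hn
      refine le_trans ?_ (mul_le_mul_of_nonneg_left hn (by norm_num))
      rw [← intervalIntegral.integral_const_mul]
      refine intervalIntegral.norm_integral_le_of_norm_le hcc (Eventually.of_forall fun t ht => ?_)
        (i0'.norm.const_mul 4)
      rw [norm_mul, mul_comm, Complex.norm_real]
      exact mul_le_mul_of_nonneg_right (bd'' t (Ioc_subset_Icc_self ht)) (norm_nonneg _)
    · have hn := integral_norm_le_sqrt_mul_lpNorm hcc hm.memLp_two
      rw [add_sub_cancel_left, Real.sqrt_one, one_mul] at hn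
      refine le_trans ?_ hn
      refine intervalIntegral.norm_integral_le_of_norm_le hcc (Eventually.of_forall fun t ht => ?_)
        i2.norm
      rw [norm_mul, Complex.norm_real]
      exact mul_le_of_le_one_right (norm_nonneg _) (bd t (Ioc_subset_Icc_self ht))
  -- The first weight isolates φ₁(c) + 2φ(c), the second isolates φ(c). The triangle inequality then
  -- costs a factor 3, whence 12 = 3 · 4.
  have k1 := key (fun x => (c + 1 - x) ^ 2) (fun x => -2 * (c + 1 - x)) (fun _ => 2)
    (fun x => by
      convert! ((hasDerivAt_id x).const_sub (c + 1)).pow 2 using 1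
      simp)
    (fun x => by
      convert! ((hasDerivAt_id x).const_sub (c + 1)).const_mul (-2) using 1
      simp)
    continuous_const (by simp) (by simp)
    (fun x hx => by
      rw [abs_of_nonneg (sq_nonneg _)]
      exact pow_le_one₀ (by linarith [hx.2]) (by linarith [hx.1]))
    (fun x hx => by norm_num)
  have k2 := key (fun x => (x - c) * (c + 1 - x) ^ 2)
    (fun x => (c + 1 - x) ^ 2 + (x - c) * (-2 * (c + 1 - x)))
    (fun x => 6 * (x - c) - 4)
    (fun x => by
      convert! ((hasDerivAt_id x).sub_const c).mul
        (((hasDerivAt_id x).const_sub (c + 1)).pow 2) using 1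
      simp)
    (fun x => by
      convert! (((hasDerivAt_id x).const_sub (c + 1)).pow 2).add
        (((hasDerivAt_id x).sub_const c).mul
          (((hasDerivAt_id x).const_sub (c + 1)).const_mul (-2))) using 1
      simp; ring)
    (by fun_prop) (by simp) (by simp)
    (fun x hx => by
      have h1 : 0 ≤ x - c := by linarith [hx.1]
      have h2 : 0 ≤ c + 1 - x := by linarith [hx.2]
      rw [abs_of_nonneg (by positivity)]
      exact mul_le_one₀ (by linarith) (by positivity) (pow_le_one₀ h2 (by linarith)))
    (fun x hx => by rw [abs_le]; constructor <;> linarith [hx.1, hx.2])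
  simp only [add_sub_cancel_left, one_pow, sub_self, zero_mul, mul_one] at k1 k2
  have n0 : 0 ≤ lpNorm φ 2 (volume.restrict (Ioc c (c + 1))) := lpNorm_nonneg
  have n2 : 0 ≤ lpNorm φ₂ 2 (volume.restrict (Ioc c (c + 1))) := lpNorm_nonneg
  simp at k1 k2
  have k3 : ‖φ₁ c‖ ≤ ‖φ₁ c + 2 * φ c‖ + 2 * ‖φ c‖ := by
    have := norm_sub_le (φ₁ c + 2 * φ c) (2 * φ c)
    rwa [add_sub_cancel_right, norm_mul, Complex.norm_ofNat] at this
  constructor <;> linarith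

end IsW22

/-! ### The energy identity -/

namespace IsW22

variable {Ω : Set ℝ} {φ φ₁ φ₂ : ℝ → ℂ}

/-- The imaginary part of `φ₁ φ̄` is a primitive of the imaginary part of `φ₂ φ̄`. -/
theorem im_one_mul_conj_sub (h : IsW22 Ω φ φ₁ φ₂) {a b : ℝ} (hab : uIcc a b ⊆ Ω) :
    (φ₁ b * conj (φ b)).im - (φ₁ a * conj (φ a)).im =
      ∫ x in a..b, (φ₂ x * conj (φ x)).im := by
  have i1 : IntervalIntegrable φ₁ volume a b := (h.continuousOn_one hab).intervalIntegrable
  have i1c : IntervalIntegrable (fun x => conj (φ₁ x)) volume a b :=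
    (Complex.continuous_conj.comp_continuousOn (h.continuousOn_one hab)).intervalIntegrable
  have hφc : ContinuousOn (fun x => conj (φ x)) (uIcc a b) :=
    Complex.continuous_conj.comp_continuousOn (h.continuousOn.mono hab)
  have key := h.one_mul_sub hab (G := fun x => conj (φ x)) (g := fun x => conj (φ₁ x)) i1c
    (fun x hx => by
      rw [← map_sub, h.sub_eq_integral_one ((uIcc_subset_uIcc_left hx).trans hab)]
      simp only [intervalIntegral.intervalIntegral_eq_integral_uIoc, integral_conj]
      split_ifs <;> simp)
  have j : IntervalIntegrable (fun x => φ₂ x * conj (φ x) + φ₁ x * conj (φ₁ x)) volume a b :=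
    ((h.intervalIntegrable_two hab).mul_continuousOn hφc).add
      (i1c.continuousOn_mul (h.continuousOn_one hab))
  have e := Complex.imCLM.intervalIntegral_comp_comm j
  rw [← key] at e
  simp only [Complex.imCLM_apply, Complex.sub_im] at e
  rw [← e]
  refine intervalIntegral.integral_congr fun x _ => ?_
  simp only [Complex.add_im, Complex.mul_conj, Complex.ofReal_im, add_zero]

theorem integrableOn_two_mul_conj (h : IsW22 Ω φ φ₁ φ₂) :
    IntegrableOn (fun x => φ₂ x * conj (φ x)) Ω :=
  h.memLp_two.integrable_mul h.memLp.star

theorem integrableOn_one_mul_conj (h : IsW22 Ω φ φ₁ φ₂) :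
    IntegrableOn (fun x => φ₁ x * conj (φ x)) Ω :=
  h.memLp_one.integrable_mul h.memLp.star

/-- The boundary term Im(φ₁ φ̄) converges at +∞ because its derivative is integrable, and it is
itself integrable, so its limit is 0. -/
theorem setIntegral_Ioi_im (h : IsW22 Ω φ φ₁ φ₂) {c : ℝ} (hc : Ici c ⊆ Ω) :
    ∫ x in Ioi c, (φ₂ x * conj (φ x)).im = -(φ₁ c * conj (φ c)).im := by
  have i2 : IntegrableOn (fun x => (φ₂ x * conj (φ x)).im) (Ioi c) :=
    (h.integrableOn_two_mul_conj.mono_set (Ioi_subset_Ici_self.trans hc)).im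
  have i1 : IntegrableOn (fun x => (φ₁ x * conj (φ x)).im) (Ioi c) :=
    (h.integrableOn_one_mul_conj.mono_set (Ioi_subset_Ici_self.trans hc)).im
  have l1 := intervalIntegral_tendsto_integral_Ioi c i2 tendsto_id
  have l2 : Tendsto (fun x => (φ₁ x * conj (φ x)).im) atTop
      (𝓝 ((φ₁ c * conj (φ c)).im + ∫ x in Ioi c, (φ₂ x * conj (φ x)).im)) := by
    refine (l1.const_add _).congr' ?_
    filter_upwards [eventually_ge_atTop c] with x hx
    rw [id, ← h.im_one_mul_conj_sub (by rw [uIcc_of_le hx]; exact Icc_subset_Ici_self.trans hc)]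
    ring
  have l3 := IntegrableAtFilter.eq_zero_of_tendsto ⟨Ioi c, Ioi_mem_atTop c, i1⟩ (fun s hs => by
    obtain ⟨b, hb⟩ := mem_atTop_sets.1 hs
    rw [← top_le_iff, ← Real.volume_Ici (a := b)]
    exact measure_mono hb) l2
  linarith

theorem setIntegral_Iic_im (h : IsW22 Ω φ φ₁ φ₂) {c : ℝ} (hc : Iic c ⊆ Ω) :
    ∫ x in Iic c, (φ₂ x * conj (φ x)).im = (φ₁ c * conj (φ c)).im := by
  have := h.comp_neg.setIntegral_Ioi_im (c := -c) (fun x hx => hc (by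
    simp only [mem_Ici, mem_Iic] at hx ⊢; linarith))
  rw [integral_comp_neg_Ioi (-c) (fun x => (φ₂ x * conj (φ x)).im)] at this
  simpa using this

end IsW22

/-! ### Symmetric operators -/

/-- Since ⟪p, q⟫ is real, the imaginary part of ⟪p, q - z p⟫ is -Im z ‖p‖²; Cauchy-Schwarz does the
rest. This gives injectivity of A - z and the resolvent bound |Im z|⁻¹, uniform in the potential. -/
theorem abs_im_mul_norm_le {p q : L2R} (h : (⟪p, q⟫_ℂ).im = 0) (z : ℂ) :
    |z.im| * ‖p‖ ≤ ‖q - z • p‖ := by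
  rcases (norm_nonneg p).eq_or_lt with h0 | h0
  · rw [← h0]; simp
  refine le_of_mul_le_mul_right ?_ h0
  have h1 : (⟪p, q - z • p⟫_ℂ).im = -z.im * (‖p‖ * ‖p‖) := by
    rw [inner_sub_right, inner_smul_right, Complex.sub_im, h, inner_self_eq_norm_sq_to_K]
    have : ((‖p‖ : ℂ) ^ 2) = ((‖p‖ * ‖p‖ : ℝ) : ℂ) := by push_cast; ring
    simp only [Complex.coe_algebraMap, this, Complex.im_mul_ofReal]
    ring
  calc |z.im| * ‖p‖ * ‖p‖ = |(⟪p, q - z • p⟫_ℂ).im| := by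
        rw [h1, abs_mul, abs_neg, abs_mul_self, mul_assoc]
    _ ≤ ‖⟪p, q - z • p⟫_ℂ‖ := Complex.abs_im_le_norm _
    _ ≤ ‖q - z • p‖ * ‖p‖ := by rw [mul_comm]; exact norm_inner_le_norm _ _

/-- A real potential contributes V|φ|², which has no imaginary part, so symmetry becomes a matter of
boundary terms of φ alone. -/
theorem im_inner_eq_neg_integral {p q : L2R} {V : ℝ → ℝ} {φ φ₂ : ℝ → ℂ} (h1 : p =ᵐ[volume] φ)
    (h2 : q =ᵐ[volume] fun x => -φ₂ x + (V x : ℂ) * φ x) :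
    (⟪p, q⟫_ℂ).im = -∫ x, (φ₂ x * conj (φ x)).im := by
  rw [L2.inner_def]
  refine (integral_im (L2.integrable_inner (𝕜 := ℂ) p q)).symm.trans ?_
  rw [← integral_neg]
  refine integral_congr_ae ?_
  filter_upwards [h1, h2] with x a b
  rw [a, b, RCLike.inner_apply]
  have := Complex.mul_conj (φ x)
  rw [add_mul, mul_assoc, this, ← Complex.ofReal_mul]
  simp only [RCLike.im_to_complex, Complex.add_im, Complex.ofReal_im, neg_mul, Complex.neg_im,
    add_zero]

theorem schrodingerGraph_im_inner {V : ℝ → ℝ} {p : L2R × L2R} (hp : p ∈ schrodingerGraph V) :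
    (⟪p.1, p.2⟫_ℂ).im = 0 := by
  obtain ⟨φ, φ₁, φ₂, h, h1, h2⟩ := hp
  have e2 := im_inner_eq_neg_integral h1 h2
  have i : IntegrableOn (fun x => (φ₂ x * conj (φ x)).im) univ :=
    h.integrableOn_two_mul_conj.im
  rw [e2, ← intervalIntegral.integral_Iic_add_Ioi (b := 0) (i.mono_set (subset_univ _))
    (i.mono_set (subset_univ _)), h.setIntegral_Ioi_im (subset_univ _),
    h.setIntegral_Iic_im (subset_univ _)]
  ring

theorem restrict_compl_zero : (volume : Measure ℝ).restrict {0}ᶜ = volume :=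
  Measure.restrict_eq_self_of_ae_mem (compl_mem_ae_iff.2 (measure_singleton 0))

theorem pointInteractionGraph_im_inner {γ₁ γ₂ : ℝ} (hγ : γ₁ ≠ 0) {p : L2R × L2R}
    (hp : p ∈ pointInteractionGraph γ₁ γ₂) : (⟪p.1, p.2⟫_ℂ).im = 0 := by
  obtain ⟨φ, φ₁, φ₂, h, ⟨l, m, l1, l2, l3, l4⟩, h1, h2⟩ := hp
  have e2 := im_inner_eq_neg_integral (V := 0) h1 (by simpa using h2)
  have i : IntegrableOn (fun x => (φ₂ x * conj (φ x)).im) univ := by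
    have : IntegrableOn (fun x => (φ₂ x * conj (φ x)).im) {0}ᶜ :=
      h.integrableOn_two_mul_conj.im
    rwa [IntegrableOn, restrict_compl_zero, ← integrableOn_univ] at this
  -- The half-line identities require closed half-lines avoiding 0. They are applied at c ≠ 0 and
  -- then c tends to 0 from each side.
  have hcont (a : ℝ) : Tendsto (fun c => ∫ x in Iic c, (φ₂ x * conj (φ x)).im) (𝓝 a)
      (𝓝 (∫ x in Iic a, (φ₂ x * conj (φ x)).im)) := by
    have i' := integrableOn_univ.1 i
    have := ((intervalIntegral.continuous_primitive (fun _ _ => i'.intervalIntegrable) a).tendsto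
      a).const_add (∫ x in Iic a, (φ₂ x * conj (φ x)).im)
    rw [intervalIntegral.integral_same, add_zero] at this
    refine this.congr fun c => ?_
    rw [← intervalIntegral.integral_Iic_sub_Iic i'.integrableOn i'.integrableOn]
    ring
  have eR : Tendsto (fun c => ∫ x in Ioi c, (φ₂ x * conj (φ x)).im) (𝓝[>] 0)
      (𝓝 (∫ x in Ioi 0, (φ₂ x * conj (φ x)).im)) := by
    have e (c : ℝ) := intervalIntegral.integral_Iic_add_Ioi (b := c) (i.mono_set (subset_univ _))
      (i.mono_set (subset_univ _))
    have := ((hcont 0).const_sub (∫ x, (φ₂ x * conj (φ x)).im)).mono_left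
      (nhdsWithin_le_nhds (s := Ioi 0))
    rw [show ∫ x in Ioi 0, (φ₂ x * conj (φ x)).im = (∫ x, (φ₂ x * conj (φ x)).im) -
      ∫ x in Iic 0, (φ₂ x * conj (φ x)).im by rw [← e 0]; ring]
    refine this.congr fun c => ?_
    rw [← e c]; ring
  have eL : Tendsto (fun c => ∫ x in Iic c, (φ₂ x * conj (φ x)).im) (𝓝[<] 0)
      (𝓝 (∫ x in Iic 0, (φ₂ x * conj (φ x)).im)) :=
    (hcont 0).mono_left nhdsWithin_le_nhds
  have fR := tendsto_nhds_unique eR (((Complex.continuous_im.tendsto _).comp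
      (l4.mul ((Complex.continuous_conj.tendsto _).comp l3))).neg.congr' (by
    filter_upwards [self_mem_nhdsWithin] with c hc
    exact (h.setIntegral_Ioi_im (fun x hx => (lt_of_lt_of_le hc hx).ne')).symm))
  have fL := tendsto_nhds_unique eL (((Complex.continuous_im.tendsto _).comp
      (l2.mul ((Complex.continuous_conj.tendsto _).comp l1))).congr' (by
    filter_upwards [self_mem_nhdsWithin] with c hc
    exact (h.setIntegral_Iic_im (fun x hx => (lt_of_le_of_lt hx hc).ne)).symm))
  rw [e2, ← intervalIntegral.integral_Iic_add_Ioi (b := 0) (i.mono_set (subset_univ _))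
    (i.mono_set (subset_univ _)), fR, fL, map_mul, Complex.conj_ofReal]
  -- The factors γ₁⁻¹ and γ₁ cancel, so the boundary terms at +0 and -0 differ by the real number
  -- γ₁γ₂|l|². This is the symmetry of the interface conditions.
  have e3 : ((γ₁ : ℂ)⁻¹ * m + γ₂ * l) * (γ₁ * conj l) = m * conj l + (γ₁ * γ₂ : ℝ) * (l * conj l) := by
    have : (γ₁ : ℂ) ≠ 0 := by exact_mod_cast hγ
    push_cast
    field_simp
  rw [e3, Complex.mul_conj l, ← Complex.ofReal_mul]
  simp

/-- A bounded below and surjective `A - z` has a bounded inverse. -/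
theorem exists_isResolvent {A : L2R →ₗ.[ℂ] L2R} {z : ℂ} {c : ℝ} (hc : 0 < c)
    (hb : ∀ p ∈ A.graph, c * ‖p.1‖ ≤ ‖p.2 - z • p.1‖)
    (hs : ∀ f : L2R, ∃ y : L2R, (y, f + z • y) ∈ A.graph) :
    ∃ R : L2R →L[ℂ] L2R, IsResolvent A z R ∧ ∀ f, (R f, f + z • R f) ∈ A.graph := by
  choose r hr using hs
  have huniq (f y : L2R) (hy : (y, f + z • y) ∈ A.graph) : y = r f := by
    have := hb _ (A.graph.sub_mem hy (hr f))
    have e : (f + z • y - (f + z • r f)) - z • (y - r f) = 0 := by module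
    simp only [Prod.mk_sub_mk, e, norm_zero] at this
    have h0 : ‖y - r f‖ = 0 := le_antisymm (by
      by_contra! h
      have := mul_pos hc h
      linarith) (norm_nonneg _)
    exact sub_eq_zero.1 (norm_eq_zero.1 h0)
  let R₀ : L2R →ₗ[ℂ] L2R :=
    { toFun := r
      map_add' := fun f g => by
        refine (huniq _ _ ?_).symm
        convert! A.graph.add_mem (hr f) (hr g) using 1
        ext1
        · rfl
        · simp only [Prod.mk_add_mk]; module
      map_smul' := fun a f => by
        refine (huniq _ _ ?_).symm
        convert! A.graph.smul_mem a (hr f) using 1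
        ext1
        · rfl
        · simp only [Prod.smul_mk, RingHom.id_apply]; module }
  let R : L2R →L[ℂ] L2R := R₀.mkContinuous c⁻¹ fun f => by
    have := hb _ (hr f)
    simp only [add_sub_cancel_right] at this
    rw [inv_mul_eq_div, le_div_iff₀ hc, mul_comm]
    exact this
  have hR (f : L2R) : R f = r f := rfl
  refine ⟨R, ⟨fun f => ?_, fun y => ?_⟩, fun f => hr f⟩
  · obtain ⟨y, e1, e2⟩ := A.mem_graph_iff.1 (hr f)
    obtain ⟨y, hy⟩ := y
    simp only at e1 e2
    subst e1
    exact ⟨hy, sub_eq_iff_eq_add.2 e2⟩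
  · rw [hR]
    refine (huniq _ _ ?_).symm
    rw [sub_add_cancel]
    exact A.mem_graph y

/-! ### The free resolvent -/

theorem sq_integral_mul_le {μ : Measure ℝ} {f g : ℝ → ℝ} (hf : MemLp f 2 μ) (hg : MemLp g 2 μ)
    (hf0 : ∀ x, 0 ≤ f x) (hg0 : ∀ x, 0 ≤ g x) :
    (∫ x, f x * g x ∂μ) ^ 2 ≤ (∫ x, f x ^ 2 ∂μ) * ∫ x, g x ^ 2 ∂μ := by
  have h2 : ENNReal.ofReal 2 = 2 := by norm_num
  have h := integral_mul_le_Lp_mul_Lq_of_nonneg (μ := μ) Real.HolderConjugate.two_two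
    (Eventually.of_forall hf0) (Eventually.of_forall hg0) (by rwa [h2]) (by rwa [h2])
  simp only [Real.rpow_two, ← Real.sqrt_eq_rpow] at h
  have h0 : 0 ≤ ∫ x, f x * g x ∂μ := integral_nonneg fun x => mul_nonneg (hf0 x) (hg0 x)
  have hA : 0 ≤ ∫ x, f x ^ 2 ∂μ := integral_nonneg fun x => sq_nonneg _
  have hB : 0 ≤ ∫ x, g x ^ 2 ∂μ := integral_nonneg fun x => sq_nonneg _
  calc (∫ x, f x * g x ∂μ) ^ 2 ≤ (√(∫ x, f x ^ 2 ∂μ) * √(∫ x, g x ^ 2 ∂μ)) ^ 2 :=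
        pow_le_pow_left₀ h0 h 2
    _ = _ := by rw [mul_pow, Real.sq_sqrt hA, Real.sq_sqrt hB]

/-- The square-integrable solution of `p' = λ p + f` for `Re λ < 0`. -/
theorem exists_memLp_primitive_eq {f : ℝ → ℂ} (hf : MemLp f 2 volume) {w : ℂ} (hw : w.re < 0) :
    ∃ p : ℝ → ℂ, Continuous p ∧ MemLp p 2 volume ∧
      ∀ a b, p b - p a = ∫ x in a..b, (w * p x + f x) := by
  set κ := -w.re with hκ
  have hκ0 : 0 < κ := by linarith
  have hnorm (c : ℂ) (x : ℝ) : ‖Complex.exp (c * x)‖ = Real.exp (c.re * x) := by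
    rw [Complex.norm_exp]; simp
  have hmem (x : ℝ) {c : ℂ} (hc : 0 < c.re) :
      MemLp (fun s : ℝ => Complex.exp (c * s)) 2 (volume.restrict (Iic x)) := by
    refine (memLp_two_iff_integrable_sq_norm
      (by fun_prop : Continuous _).aestronglyMeasurable).2 ?_
    refine (integrableOn_exp_mul_Iic (a := 2 * c.re) (by linarith) x).congr_fun (fun s _ => ?_)
      measurableSet_Iic
    simp only [hnorm, ← Real.exp_nat_mul]
    congr 1; push_cast; ring
  have hfi (x : ℝ) : IntegrableOn (fun s : ℝ => Complex.exp (-w * s) * f s) (Iic x) :=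
    (hmem x (by simpa using hw)).integrable_mul (hf.mono_measure Measure.restrict_le_self)
  have hfii (a b : ℝ) : IntervalIntegrable (fun s : ℝ => Complex.exp (-w * s) * f s) volume a b :=
    ⟨(hfi b).mono_set Ioc_subset_Iic_self, (hfi a).mono_set Ioc_subset_Iic_self⟩
  -- Variation of constants from -∞: p(x) = e^{wx} F(x) = ∫_{s ≤ x} e^{w(x-s)} f(s) ds.
  set F : ℝ → ℂ := fun x => ∫ s in Iic x, Complex.exp (-w * s) * f s with hF
  have hFsub (a b : ℝ) : F b - F a = ∫ s in a..b, Complex.exp (-w * s) * f s :=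
    intervalIntegral.integral_Iic_sub_Iic (hfi a) (hfi b)
  have hFc : Continuous F := by
    have : F = fun x => F 0 + ∫ s in (0 : ℝ)..x, Complex.exp (-w * s) * f s := by
      funext x; rw [← hFsub]; ring
    rw [this]
    exact continuous_const.add (intervalIntegral.continuous_primitive hfii 0)
  have hec : Continuous fun x : ℝ => Complex.exp (w * x) := by fun_prop
  have hec' : Continuous fun x : ℝ => w * Complex.exp (w * x) := by fun_prop
  have hpc : Continuous fun x : ℝ => Complex.exp (w * x) * F x := hec.mul hFc
  refine ⟨fun x => Complex.exp (w * x) * F x, hpc, ?_, fun a b => ?_⟩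
  · have hf2 : Integrable fun s => ‖f s‖ ^ 2 := hf.integrable_norm_pow (by norm_num)
    -- Write the kernel e^{-κ(x-s)} as a product of two square roots. Cauchy-Schwarz gives |p|² ≤
    -- κ⁻¹ (|f|² ⋆ E), and a convolution of integrable functions is integrable.
    set E : ℝ → ℝ := (Ici 0).indicator fun t => Real.exp (-κ * t) with hE
    have hEi : Integrable E := by
      rw [hE, integrable_indicator_iff measurableSet_Ici, integrableOn_Ici_iff_integrableOn_Ioi]
      exact integrableOn_exp_mul_Ioi (by linarith) 0
    have hconv := hf2.integrable_convolution (ContinuousLinearMap.mul ℝ ℝ) hEi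
    refine (memLp_two_iff_integrable_sq_norm hpc.aestronglyMeasurable).2 ?_
    refine (hconv.const_mul κ⁻¹).mono' (hpc.norm.pow 2).aestronglyMeasurable
      (Eventually.of_forall fun x => ?_)
    have e1 : ((fun s => ‖f s‖ ^ 2) ⋆[ContinuousLinearMap.mul ℝ ℝ, volume] E) x =
        ∫ s in Iic x, (Real.exp (κ / 2 * (s - x)) * ‖f s‖) ^ 2 := by
      rw [convolution_def, ← integral_indicator measurableSet_Iic]
      refine integral_congr_ae (Eventually.of_forall fun s => ?_)
      by_cases hs : s ≤ x
      · simp only [hE, ContinuousLinearMap.mul_apply']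
        rw [indicator_of_mem (show s ∈ Iic x from hs),
          indicator_of_mem (show x - s ∈ Ici (0 : ℝ) from sub_nonneg.2 hs), mul_pow,
          ← Real.exp_nat_mul, mul_comm]
        congr 2; push_cast; ring
      · simp only [hE, ContinuousLinearMap.mul_apply']
        rw [indicator_of_notMem (show s ∉ Iic x from hs),
          indicator_of_notMem (show x - s ∉ Ici (0 : ℝ) from fun h => hs (sub_nonneg.1 h)),
          mul_zero]
    have hexp : MemLp (fun s => Real.exp (κ / 2 * (s - x))) 2 (volume.restrict (Iic x)) := by
      have := (hmem x (c := ((κ / 2 : ℝ) : ℂ)) (by rw [Complex.ofReal_re]; positivity)).norm.const_mul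
        (Real.exp (-(κ / 2 * x)))
      refine (memLp_congr_ae (Eventually.of_forall fun s => ?_)).1 this
      simp only [hnorm, Complex.ofReal_re, ← Real.exp_add]
      congr 1; ring
    have e2 : ∫ s in Iic x, Real.exp (κ / 2 * (s - x)) ^ 2 = κ⁻¹ := by
      have : ∀ s, Real.exp (κ / 2 * (s - x)) ^ 2 = Real.exp (-(κ * x)) * Real.exp (κ * s) := by
        intro s
        rw [← Real.exp_nat_mul, ← Real.exp_add]
        congr 1; push_cast; ring
      simp only [this]
      rw [integral_const_mul, integral_exp_mul_Iic hκ0, mul_div_assoc', ← Real.exp_add]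
      simp
    have hexpf : MemLp (fun s => Real.exp (κ / 2 * (s - x)) * ‖f s‖) 2
        (volume.restrict (Iic x)) := by
      refine (hf.norm.mono_measure Measure.restrict_le_self).of_le
        ((by fun_prop : Continuous fun s => Real.exp (κ / 2 * (s - x))).aestronglyMeasurable.mul
          (hf.1.norm.mono_measure Measure.restrict_le_self)) ?_
      refine (ae_restrict_iff' measurableSet_Iic).2 (Eventually.of_forall fun s hs => ?_)
      rw [norm_mul]
      refine mul_le_of_le_one_left (norm_nonneg _) ?_
      rw [Real.norm_of_nonneg (Real.exp_nonneg _), Real.exp_le_one_iff]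
      exact mul_nonpos_of_nonneg_of_nonpos (by positivity) (sub_nonpos.2 hs)
    have hcs := sq_integral_mul_le hexp hexpf (fun s => Real.exp_nonneg _)
      (fun s => mul_nonneg (Real.exp_nonneg _) (norm_nonneg _))
    rw [e2, ← e1] at hcs
    refine le_trans ?_ hcs
    rw [Real.norm_of_nonneg (by positivity)]
    refine pow_le_pow_left₀ (norm_nonneg _) ?_ 2
    rw [hF, ← integral_const_mul]
    refine (norm_integral_le_integral_norm _).trans_eq ?_
    refine integral_congr_ae (Eventually.of_forall fun s => ?_)
    simp only [norm_mul, hnorm]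
    rw [← mul_assoc, ← mul_assoc, ← Real.exp_add, ← Real.exp_add]
    congr 2
    simp only [Complex.neg_re, hκ]; ring
  · have hd (a x : ℝ) : Complex.exp (w * x) - Complex.exp (w * a) =
        ∫ t in a..x, w * Complex.exp (w * t) := by
      refine (intervalIntegral.integral_eq_sub_of_hasDerivAt (f := fun t : ℝ => Complex.exp (w * t))
        (fun t _ => ?_) (hec'.intervalIntegrable _ _)).symm
      have := ((hasDerivAt_id t).ofReal_comp.const_mul w).cexp
      simpa [mul_comm] using this
    have := mul_sub_mul_eq_integral_of_primitive (a := a) (b := b) (hec'.intervalIntegrable a b)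
      (hfii a b) (F := fun x : ℝ => Complex.exp (w * x)) (fun x _ => hd a x)
      (fun x _ => hFsub a x)
    rw [this]
    refine intervalIntegral.integral_congr fun x _ => ?_
    have he : Complex.exp (w * x) * Complex.exp (-w * x) = 1 := by
      rw [← Complex.exp_add]; simp
    simp only
    linear_combination f x * he

/-- If w² is not real, neither part of w vanishes, and the sign of the real part can be chosen. A
negative real part makes e^{wx} decay at +∞; the nonzero imaginary part later keeps the determinant
of the interface system from vanishing. -/
theorem exists_sq_eq_neg {z : ℂ} (hz : z.im ≠ 0) : ∃ w : ℂ, w ^ 2 = -z ∧ w.re < 0 ∧ w.im ≠ 0 := by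
  obtain ⟨w, hw⟩ := IsAlgClosed.exists_pow_nat_eq (-z) (n := 2) (by norm_num)
  have h : 2 * (w.re * w.im) = -z.im := by
    rw [← Complex.neg_im, ← hw, sq, Complex.mul_im]; ring
  have hre : w.re ≠ 0 := fun h0 => hz (by rw [h0] at h; linarith)
  have him : w.im ≠ 0 := fun h0 => hz (by rw [h0] at h; linarith)
  rcases hre.lt_or_gt with h0 | h0
  · exact ⟨w, hw, h0, him⟩
  · exact ⟨-w, by rw [neg_sq, hw], by simpa using h0, by simpa using him⟩

/-- The equation `-φ'' - z φ = f` is solvable in `W₂²(ℝ)`. -/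
theorem exists_isW22_free {f : ℝ → ℂ} (hf : MemLp f 2 volume) {z : ℂ} (hz : z.im ≠ 0) :
    ∃ φ φ₁ : ℝ → ℂ, IsW22 univ φ φ₁ (fun x => -z * φ x - f x) ∧ Continuous φ₁ := by
  obtain ⟨w, hwz, hw, -⟩ := exists_sq_eq_neg hz
  have hw0 : w ≠ 0 := fun h => by simp [h] at hw
  obtain ⟨p, pc, pm, hp⟩ := exists_memLp_primitive_eq hf hw
  obtain ⟨q, qc, qm, hq⟩ := exists_memLp_primitive_eq
    (hf.comp_measurePreserving (Measure.measurePreserving_neg volume)) hw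
  have qm' : MemLp (fun x => q (-x)) 2 volume :=
    qm.comp_measurePreserving (Measure.measurePreserving_neg volume)
  have hfl (a b : ℝ) : IntervalIntegrable f volume a b :=
    (hf.locallyIntegrable (by norm_num) :
      LocallyIntegrable f volume).integrableOn_isCompact isCompact_uIcc |>.intervalIntegrable
  have hq' (a b : ℝ) : q (-b) - q (-a) = ∫ x in a..b, (-(w * q (-x)) - f x) := by
    rw [hq, ← intervalIntegral.integral_comp_neg (a := b) (b := a),
      intervalIntegral.integral_symm, ← intervalIntegral.integral_neg]
    refine intervalIntegral.integral_congr fun x _ => ?_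
    simp only [Function.comp, neg_neg]; ring
  have qc' : Continuous fun x => q (-x) := by fun_prop
  have i1 (a b : ℝ) : IntervalIntegrable (fun x => w * p x + f x) volume a b :=
    ((continuous_const.mul pc).intervalIntegrable a b).add (hfl a b)
  have i2 (a b : ℝ) : IntervalIntegrable (fun x => -(w * q (-x)) - f x) volume a b :=
    ((continuous_const.mul qc').neg.intervalIntegrable a b).sub (hfl a b)
  -- With q̃(x) = q(-x), p' = wp + f and q̃' = -wq̃ - f. In φ = c(p + q̃) the sources cancel in φ'
  -- and add up to 2cw f = -f in φ'', which is therefore w²φ - f = -zφ - f.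
  set c : ℂ := -(2 * w)⁻¹ with hc
  have hcw : c * w = -1 / 2 := by rw [hc]; field_simp
  have hφ (a b : ℝ) : c * (p b + q (-b)) - c * (p a + q (-a)) =
      ∫ x in a..b, c * w * (p x - q (-x)) := by
    have : c * (p b + q (-b)) - c * (p a + q (-a)) = c * ((p b - p a) + (q (-b) - q (-a))) := by
      ring
    rw [this, hp, hq', ← intervalIntegral.integral_add (i1 a b) (i2 a b),
      ← intervalIntegral.integral_const_mul]
    refine intervalIntegral.integral_congr fun x _ => ?_
    ring
  have c1 : Continuous fun x => c * w * (p x - q (-x)) := by fun_prop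
  refine ⟨fun x => c * (p x + q (-x)), fun x => c * w * (p x - q (-x)), ⟨?_, ?_, ?_, ?_, ?_⟩, c1⟩
  · rw [Measure.restrict_univ]; exact (pm.add qm').const_mul c
  · rw [Measure.restrict_univ]; exact (pm.sub qm').const_mul (c * w)
  · rw [Measure.restrict_univ]; exact ((pm.add qm').const_mul c |>.const_mul (-z)).sub hf
  · intro x _
    have := (c1.integral_hasStrictDerivAt 0 x).hasDerivAt.const_add (c * (p 0 + q (-0)))
    refine this.congr_of_eventuallyEq (Eventually.of_forall fun y => ?_)
    simp only [← hφ 0 y]; ring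
  · intro a b _
    have : c * w * (p b - q (-b)) - c * w * (p a - q (-a)) =
        c * w * ((p b - p a) - (q (-b) - q (-a))) := by ring
    rw [this, hp, hq', ← intervalIntegral.integral_sub (i1 a b) (i2 a b),
      ← intervalIntegral.integral_const_mul]
    refine intervalIntegral.integral_congr fun x _ => ?_
    linear_combination c * (p x + q (-x)) * hwz + 2 * f x * hcw

/-! ### Resolvents of Schrödinger operators -/

/-- Multiplication by a bounded function. -/
theorem exists_mulOperator {W : ℝ → ℝ} (hW : AEMeasurable W volume) {M : ℝ} (hM : ∀ x, |W x| ≤ M) :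
    ∃ T : L2R →L[ℂ] L2R, ‖T‖ ≤ M ∧ ∀ g : L2R, T g =ᵐ[volume] fun x => (W x : ℂ) * g x := by
  have hM0 : 0 ≤ M := (abs_nonneg _).trans (hM 0)
  have hWm : AEStronglyMeasurable (fun x => (W x : ℂ)) volume :=
    (Complex.measurable_ofReal.comp_aemeasurable hW).aestronglyMeasurable
  have hle (g : L2R) : ∀ x, ‖(W x : ℂ) * g x‖ ≤ M * ‖g x‖ := fun x => by
    rw [norm_mul, Complex.norm_real]
    exact mul_le_mul_of_nonneg_right (hM x) (norm_nonneg _)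
  have hmem (g : L2R) : MemLp (fun x => (W x : ℂ) * g x) 2 volume :=
    (Lp.memLp g).of_le_mul (hWm.mul (Lp.aestronglyMeasurable g)) (Eventually.of_forall (hle g))
  let T₀ : L2R →ₗ[ℂ] L2R :=
    { toFun := fun g => (hmem g).toLp
      map_add' := fun g h => by
        rw [← MemLp.toLp_add]
        refine MemLp.toLp_congr _ _ ?_
        filter_upwards [Lp.coeFn_add g h] with x hx
        simp only [hx, Pi.add_apply, mul_add]
      map_smul' := fun a g => by
        rw [RingHom.id_apply, ← MemLp.toLp_const_smul]
        refine MemLp.toLp_congr _ _ ?_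
        filter_upwards [Lp.coeFn_smul a g] with x hx
        simp only [hx, Pi.smul_apply, smul_eq_mul]; ring }
  refine ⟨T₀.mkContinuous M fun g => ?_, LinearMap.mkContinuous_norm_le _ hM0 _, fun g =>
    (hmem g).coeFn_toLp⟩
  refine Lp.norm_le_mul_norm_of_ae_le_mul ?_
  filter_upwards [(hmem g).coeFn_toLp] with x hx
  change ‖((hmem g).toLp : L2R) x‖ ≤ _
  rw [hx]
  exact hle g x

theorem schrodinger_exists_isResolvent {V : ℝ → ℝ} {z : ℂ} (hz : z.im ≠ 0)
    (hs : ∀ f : L2R, ∃ y : L2R, (y, f + z • y) ∈ schrodingerGraph V) :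
    ∃ R : L2R →L[ℂ] L2R, IsResolvent (schrodinger V) z R ∧
      ∀ f, (R f, f + z • R f) ∈ schrodingerGraph V := by
  have := exists_isResolvent (A := schrodinger V) (z := z) (abs_pos.2 hz) (fun p hp => by
    rw [schrodinger_graph] at hp
    exact abs_im_mul_norm_le (schrodingerGraph_im_inner hp) z) (by rwa [schrodinger_graph])
  rwa [schrodinger_graph] at this

theorem schrodinger_free_surjective {z : ℂ} (hz : z.im ≠ 0) (f : L2R) :
    ∃ y : L2R, (y, f + z • y) ∈ schrodingerGraph 0 := by
  obtain ⟨φ, φ₁, h, -⟩ := exists_isW22_free (Lp.memLp f) hz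
  have hm : MemLp φ 2 volume := by simpa using h.memLp
  refine ⟨hm.toLp, φ, φ₁, _, h, hm.coeFn_toLp, ?_⟩
  filter_upwards [Lp.coeFn_add f (z • hm.toLp), Lp.coeFn_smul z hm.toLp, hm.coeFn_toLp]
    with x h1 h2 h3
  rw [h1, Pi.add_apply, h2, Pi.smul_apply, h3]
  simp

/-- Solvability is stable under perturbations of the potential smaller than `|Im z|`. -/
theorem schrodinger_surjective_add {V W : ℝ → ℝ} {z : ℂ} (hW : AEMeasurable W volume) {M : ℝ}
    (hM : ∀ x, |W x| ≤ M) (hMz : M < |z.im|)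
    (hs : ∀ f : L2R, ∃ y : L2R, (y, f + z • y) ∈ schrodingerGraph V) (f : L2R) :
    ∃ y : L2R, (y, f + z • y) ∈ schrodingerGraph (V + W) := by
  have hM0 : 0 ≤ M := (abs_nonneg _).trans (hM 0)
  have hz0 : 0 < |z.im| := hM0.trans_lt hMz
  obtain ⟨R, -, hR⟩ := schrodinger_exists_isResolvent (abs_pos.1 hz0) hs
  obtain ⟨T, hT, hTW⟩ := exists_mulOperator hW hM
  have hRn : ‖R‖ ≤ |z.im|⁻¹ := R.opNorm_le_bound (by positivity) fun g => by
    have := abs_im_mul_norm_le (schrodingerGraph_im_inner (hR g)) z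
    simp only [add_sub_cancel_right] at this
    rw [inv_mul_eq_div, le_div_iff₀ hz0, mul_comm]
    exact this
  -- With R the resolvent for V and T multiplication by W, R g solves the perturbed equation as soon
  -- as (1 + T R) g = f. The symmetry bound on R makes the Neumann series converge.
  have hK : ‖-(T * R)‖ < 1 := by
    rw [norm_neg]
    refine (norm_mul_le _ _).trans_lt ?_
    refine (mul_le_mul hT hRn (norm_nonneg _) hM0).trans_lt ?_
    rwa [← div_eq_mul_inv, div_lt_one hz0]
  obtain ⟨u, hu⟩ := isUnit_one_sub_of_norm_lt_one hK
  set g : L2R := (↑u⁻¹ : L2R →L[ℂ] L2R) f with hg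
  have hgf : g + T (R g) = f := by
    have h1 : (u : L2R →L[ℂ] L2R) g = f := by
      rw [hg, ← mul_apply_eq_comp, u.mul_inv]; rfl
    rw [hu] at h1
    simpa [mul_apply_eq_comp] using h1
  obtain ⟨φ, φ₁, φ₂, h, h1, h2⟩ := hR g
  refine ⟨R g, φ, φ₁, φ₂, h, h1, ?_⟩
  have e : f + z • R g = (g + z • R g) + T (R g) := by rw [← hgf]; abel
  simp only at h1 h2 ⊢
  rw [e]
  filter_upwards [Lp.coeFn_add (g + z • R g) (T (R g)), h1, h2, hTW (R g)] with x a b c d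
  rw [a, Pi.add_apply, c, d, b]
  simp only [Pi.add_apply, Complex.ofReal_add]; ring

/-- Continuity method: V is added in n equal portions, each smaller than |Im z|. The admissible step
does not shrink along the way, because the resolvent bound |Im z|⁻¹ is the same for every real
potential. -/
theorem schrodinger_surjective {V : ℝ → ℝ} {z : ℂ} (hz : z.im ≠ 0) (hV : AEMeasurable V volume)
    {M : ℝ} (hM : ∀ x, |V x| ≤ M) (f : L2R) :
    ∃ y : L2R, (y, f + z • y) ∈ schrodingerGraph V := by
  have hz0 : 0 < |z.im| := abs_pos.2 hz
  have hM0 : 0 ≤ M := (abs_nonneg _).trans (hM 0)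
  obtain ⟨n, hn⟩ := exists_nat_gt (M / |z.im|)
  have hn0 : (0 : ℝ) < n := (by positivity : 0 ≤ M / |z.im|).trans_lt hn
  have key (j : ℕ) : ∀ f : L2R, ∃ y : L2R,
      (y, f + z • y) ∈ schrodingerGraph ((j / n : ℝ) • V) := by
    induction j with
    | zero =>
      intro f
      simpa using schrodinger_free_surjective hz f
    | succ j ih =>
      intro f
      have e : (((j + 1 : ℕ) / n : ℝ) • V) = ((j / n : ℝ) • V) + ((1 / n : ℝ) • V) := by
        rw [← add_smul]; push_cast; congr 1; ring
      rw [e]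
      refine schrodinger_surjective_add (M := M / n) (hV.const_smul _) (fun x => ?_) ?_ ih f
      · rw [Pi.smul_apply, smul_eq_mul, abs_mul, abs_of_pos (by positivity), one_div_mul_eq_div]
        exact div_le_div_of_nonneg_right (hM x) hn0.le
      · rw [div_lt_iff₀ hn0]; rwa [div_lt_iff₀ hz0, mul_comm] at hn
  have := key n f
  rwa [div_self hn0.ne', one_smul] at this

/-! ### Resolvents of point interactions -/

theorem memLp_exp_Ioi {w : ℂ} (hw : w.re < 0) (c : ℝ) :
    MemLp (fun x : ℝ => Complex.exp (w * x)) 2 (volume.restrict (Ioi c)) := by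
  refine (memLp_two_iff_integrable_sq_norm
    (by fun_prop : Continuous _).aestronglyMeasurable).2 ?_
  refine (integrableOn_exp_mul_Ioi (a := 2 * w.re) (by linarith) c).congr_fun (fun s _ => ?_)
    measurableSet_Ioi
  simp only [Complex.norm_exp, ← Real.exp_nat_mul]
  congr 1; simp; ring

theorem memLp_ite_exp {w : ℂ} (hw : w.re < 0) (a b : ℂ) :
    MemLp (fun x : ℝ => if x < 0 then a * Complex.exp (w * (-x : ℝ)) else b * Complex.exp (w * x))
      2 volume := by
  refine MemLp.piecewise (s := Iio 0) (f := fun x : ℝ => a * Complex.exp (w * (-x : ℝ)))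
    (g := fun x : ℝ => b * Complex.exp (w * x)) measurableSet_Iio ?_ ?_
  · have := IsW22.memLp_comp_neg (memLp_exp_Ioi hw 0)
    rw [show Neg.neg ⁻¹' Ioi (0 : ℝ) = Iio 0 by ext; simp] at this
    exact this.const_mul a
  · rw [compl_Iio, ← Measure.restrict_congr_set Ioi_ae_eq_Ici]
    exact (memLp_exp_Ioi hw 0).const_mul b

theorem isW22_ite_exp {w : ℂ} (hw : w.re < 0) (a b : ℂ) :
    IsW22 {0}ᶜ
      (fun x : ℝ => if x < 0 then a * Complex.exp (w * (-x : ℝ)) else b * Complex.exp (w * x))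
      (fun x : ℝ => if x < 0 then (-(w * a)) * Complex.exp (w * (-x : ℝ)) else
        (w * b) * Complex.exp (w * x))
      (fun x : ℝ => if x < 0 then (w ^ 2 * a) * Complex.exp (w * (-x : ℝ)) else
        (w ^ 2 * b) * Complex.exp (w * x)) := by
  have dR (c : ℂ) (x : ℝ) :
      HasDerivAt (fun x : ℝ => c * Complex.exp (w * x)) (w * c * Complex.exp (w * x)) x := by
    convert! (((hasDerivAt_id x).ofReal_comp.const_mul w).cexp).const_mul c using 1
    simp; ring
  have dL (c : ℂ) (x : ℝ) : HasDerivAt (fun x : ℝ => c * Complex.exp (w * (-x : ℝ)))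
      (-(w * c) * Complex.exp (w * (-x : ℝ))) x := by
    convert! ((((hasDerivAt_id x).neg).ofReal_comp.const_mul w).cexp).const_mul c using 1
    simp; ring
  have cR (c : ℂ) : Continuous fun x : ℝ => c * Complex.exp (w * x) := by fun_prop
  have cL (c : ℂ) : Continuous fun x : ℝ => c * Complex.exp (w * (-x : ℝ)) := by fun_prop
  refine ⟨(memLp_ite_exp hw _ _).restrict _, (memLp_ite_exp hw _ _).restrict _,
    (memLp_ite_exp hw _ _).restrict _, fun x hx => ?_, fun c d hcd => ?_⟩
  · rcases lt_or_gt_of_ne (show x ≠ 0 from hx) with h | h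
    · simp only [if_pos h]
      refine (dL a x).congr_of_eventuallyEq ?_
      filter_upwards [Iio_mem_nhds h] with y hy
      exact if_pos hy
    · simp only [if_neg h.not_gt]
      refine (dR b x).congr_of_eventuallyEq ?_
      filter_upwards [Ioi_mem_nhds h] with y hy
      exact if_neg (not_lt.2 (le_of_lt hy))
  · rcases lt_or_ge (max c d) 0 with h | h
    · have hneg : ∀ x ∈ uIcc c d, x < 0 := fun x hx => hx.2.trans_lt h
      rw [intervalIntegral.integral_congr (g := fun x : ℝ =>
        (w ^ 2 * a) * Complex.exp (w * (-x : ℝ))) (fun x hx => if_pos (hneg x hx)),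
        if_pos (hneg c left_mem_uIcc), if_pos (hneg d right_mem_uIcc)]
      refine (intervalIntegral.integral_eq_sub_of_hasDerivAt
        (f := fun x : ℝ => -(w * a) * Complex.exp (w * (-x : ℝ))) (fun x _ => ?_)
        ((cL _).intervalIntegrable _ _)).symm
      convert! dL (-(w * a)) x using 1; ring
    · have hpos : ∀ x ∈ uIcc c d, ¬ x < 0 := fun x hx hx0 => by
        have : (0 : ℝ) ∈ uIcc c d := ⟨hx.1.trans hx0.le, h⟩
        exact hcd this rfl
      rw [intervalIntegral.integral_congr (g := fun x : ℝ =>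
        (w ^ 2 * b) * Complex.exp (w * x)) (fun x hx => if_neg (hpos x hx)),
        if_neg (hpos c left_mem_uIcc), if_neg (hpos d right_mem_uIcc)]
      refine (intervalIntegral.integral_eq_sub_of_hasDerivAt
        (f := fun x : ℝ => w * b * Complex.exp (w * x)) (fun x _ => ?_)
        ((cR _).intervalIntegrable _ _)).symm
      convert! dR (w * b) x using 1; ring

/-- The free solution has no jump at 0. Adding a e^{-wx} on the left and b e^{wx} on the right,
which solve the homogeneous equation, reduces the two interface conditions to a linear system for a
and b. -/
theorem pointInteraction_surjective {γ₁ γ₂ : ℝ} (hγ : γ₁ ≠ 0) {z : ℂ} (hz : z.im ≠ 0) (f : L2R) :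
    ∃ y : L2R, (y, f + z • y) ∈ pointInteractionGraph γ₁ γ₂ := by
  obtain ⟨φ, φ₁, h, hc⟩ := exists_isW22_free (Lp.memLp f) hz
  obtain ⟨w, hwz, hw, hwi⟩ := exists_sq_eq_neg hz
  have hγ' : (γ₁ : ℂ) ≠ 0 := by exact_mod_cast hγ
  -- This is the determinant of that system; its imaginary part is (γ₁² + 1) Im w.
  have hdet : w * (γ₁ ^ 2 + 1) - γ₁ * γ₂ ≠ 0 := fun h0 => by
    have := congrArg Complex.im h0
    have e : (w * (γ₁ ^ 2 + 1) - γ₁ * γ₂ : ℂ) = w * (γ₁ ^ 2 + 1 : ℝ) - (γ₁ * γ₂ : ℝ) := by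
      push_cast; ring
    rw [e, Complex.sub_im, Complex.im_mul_ofReal, Complex.ofReal_im, sub_zero,
      Complex.zero_im] at this
    exact (mul_ne_zero hwi (by positivity)) this
  set l := φ 0
  set m := φ₁ 0
  set a : ℂ := ((m - γ₁ * m) + γ₁ * γ₂ * l - γ₁ * w * (γ₁ - 1) * l) /
    (w * (γ₁ ^ 2 + 1) - γ₁ * γ₂) with ha
  set b : ℂ := γ₁ * (l + a) - l with hb
  have e1 : γ₁ * (m + w * b) = (m - w * a) + γ₁ * γ₂ * (l + a) := by
    have : a * (w * (γ₁ ^ 2 + 1) - γ₁ * γ₂) =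
        (m - γ₁ * m) + γ₁ * γ₂ * l - γ₁ * w * (γ₁ - 1) * l := by rw [ha]; field_simp
    rw [hb]
    linear_combination this
  have e2 : m + w * b = (γ₁ : ℂ)⁻¹ * (m - w * a) + γ₂ * (l + a) := by
    field_simp
    linear_combination e1
  have hX := (h.mono (subset_univ {0}ᶜ)).add (isW22_ite_exp hw a b)
  have hm : MemLp _ 2 volume := restrict_compl_zero ▸ hX.memLp
  have hφc : Continuous φ := continuous_iff_continuousAt.2 fun x =>
    (h.hasDerivAt x (mem_univ x)).continuousAt
  have lim (A B : ℂ) : Tendsto (fun x : ℝ => if x < 0 then A * Complex.exp (w * (-x : ℝ)) else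
      B * Complex.exp (w * x)) (𝓝[<] 0) (𝓝 A) ∧ Tendsto (fun x : ℝ => if x < 0 then
      A * Complex.exp (w * (-x : ℝ)) else B * Complex.exp (w * x)) (𝓝[>] 0) (𝓝 B) := by
    constructor
    · have : Tendsto (fun x : ℝ => A * Complex.exp (w * (-x : ℝ))) (𝓝 0) (𝓝 A) := by
        have := (by fun_prop : Continuous fun x : ℝ => A * Complex.exp (w * (-x : ℝ))).tendsto 0
        simpa using this
      refine (this.mono_left nhdsWithin_le_nhds).congr' ?_
      filter_upwards [self_mem_nhdsWithin] with x hx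
      exact (if_pos (mem_Iio.1 hx)).symm
    · have : Tendsto (fun x : ℝ => B * Complex.exp (w * x)) (𝓝 0) (𝓝 B) := by
        have := (by fun_prop : Continuous fun x : ℝ => B * Complex.exp (w * x)).tendsto 0
        simpa using this
      refine (this.mono_left nhdsWithin_le_nhds).congr' ?_
      filter_upwards [self_mem_nhdsWithin] with x hx
      exact (if_neg (not_lt.2 (le_of_lt hx))).symm
  refine ⟨hm.toLp, _, _, _, hX, ⟨l + a, m - w * a, ?_, ?_, ?_, ?_⟩, hm.coeFn_toLp, ?_⟩
  · exact (hφc.tendsto 0 |>.mono_left nhdsWithin_le_nhds).add (lim _ _).1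
  · rw [sub_eq_add_neg]
    exact (hc.tendsto 0 |>.mono_left nhdsWithin_le_nhds).add (lim _ _).1
  · rw [show (γ₁ : ℂ) * (l + a) = l + b by rw [hb]; ring]
    exact (hφc.tendsto 0 |>.mono_left nhdsWithin_le_nhds).add (lim _ _).2
  · rw [← e2]
    exact (hc.tendsto 0 |>.mono_left nhdsWithin_le_nhds).add (lim _ _).2
  · filter_upwards [Lp.coeFn_add f (z • hm.toLp), Lp.coeFn_smul z hm.toLp, hm.coeFn_toLp]
      with x h1 h2 h3
    rw [h1, Pi.add_apply, h2, Pi.smul_apply, h3]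
    simp only [Pi.add_apply, smul_eq_mul, hwz]
    split_ifs <;> ring

theorem pointInteraction_exists_isResolvent {γ₁ γ₂ : ℝ} (hγ : γ₁ ≠ 0) {z : ℂ} (hz : z.im ≠ 0) :
    ∃ R : L2R →L[ℂ] L2R, IsResolvent (pointInteraction γ₁ γ₂) z R ∧
      ∀ f, (R f, f + z • R f) ∈ pointInteractionGraph γ₁ γ₂ := by
  have := exists_isResolvent (A := pointInteraction γ₁ γ₂) (z := z) (abs_pos.2 hz) (fun p hp => by
    rw [pointInteraction_graph] at hp
    exact abs_im_mul_norm_le (pointInteractionGraph_im_inner hγ hp) z)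
    (by rw [pointInteraction_graph]; exact pointInteraction_surjective hγ hz)
  rwa [pointInteraction_graph] at this

/-! ### Grönwall inequalities -/

/-- The primitive I of G satisfies I' ≤ A + L I with I(a) = 0, so the differential Grönwall bound
applies to I; it is inserted back into the hypothesis. -/
theorem le_mul_exp_of_le_add_integral {G : ℝ → ℝ} (hG : Continuous G) (hG0 : ∀ t, 0 ≤ G t)
    {a b A L : ℝ} (hL : 0 < L) (h : ∀ t ∈ Icc a b, G t ≤ A + L * ∫ s in a..t, G s) :
    ∀ t ∈ Icc a b, G t ≤ A * Real.exp (L * (t - a)) := by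
  have hI : ∀ t, HasDerivAt (fun t => ∫ s in a..t, G s) (G t) t := fun t =>
    (hG.integral_hasStrictDerivAt a t).hasDerivAt
  have key := norm_le_gronwallBound_of_norm_deriv_right_le (f := fun t => ∫ s in a..t, G s)
    (f' := G) (δ := 0) (K := L) (ε := A) (a := a) (b := b)
    (fun t _ => (hI t).continuousAt.continuousWithinAt) (fun t _ => (hI t).hasDerivWithinAt)
    (by simp) (fun t ht => by
      have h0 : 0 ≤ ∫ s in a..t, G s := intervalIntegral.integral_nonneg ht.1 fun s _ => hG0 s
      rw [Real.norm_of_nonneg (hG0 t), Real.norm_of_nonneg h0, add_comm]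
      exact h t (Ico_subset_Icc_self ht))
  intro t ht
  have h1 := (le_abs_self _).trans (key t ht)
  rw [gronwallBound_of_K_ne_0 hL.ne'] at h1
  refine (h t ht).trans ?_
  have h2 := mul_le_mul_of_nonneg_left h1 hL.le
  have h3 : L * (0 * Real.exp (L * (t - a)) + A / L * (Real.exp (L * (t - a)) - 1)) =
      A * Real.exp (L * (t - a)) - A := by field_simp; ring
  linarith

/-- A Grönwall bound for an integrated second order equation with zero initial value. -/
theorem norm_le_of_second_order {w w₁ : ℝ → ℂ} (hw : ∀ t, HasDerivAt w (w₁ t) t)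
    (hw₁ : Continuous w₁) {a b A M : ℝ} (hA : 0 ≤ A) (hM : 0 ≤ M) (h0 : w a = 0)
    (h : ∀ t ∈ Icc a b, ‖w₁ t‖ ≤ A + M * ∫ s in a..t, ‖w s‖) :
    ∀ t ∈ Icc a b, ‖w t‖ ≤ A * Real.exp ((M + 1) * (b - a)) := by
  have hwc : Continuous w := continuous_iff_continuousAt.2 fun t => (hw t).continuousAt
  have hG : Continuous fun t => ‖w t‖ + ‖w₁ t‖ := by fun_prop
  intro t ht
  -- Grönwall is applied to ‖w‖ + ‖w₁‖. The extra 1 in the rate M + 1 accounts for ‖w‖ ≤ ∫‖w₁‖ and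
  -- keeps the rate positive.
  have := le_mul_exp_of_le_add_integral hG (fun t => by positivity) (a := a) (b := b) (A := A)
    (L := M + 1) (by linarith) (fun t ht => by
      have e1 : w t = ∫ s in a..t, w₁ s := by
        rw [intervalIntegral.integral_eq_sub_of_hasDerivAt (fun s _ => hw s)
          (hw₁.intervalIntegrable _ _), h0, sub_zero]
      have e2 : ‖w t‖ ≤ ∫ s in a..t, ‖w₁ s‖ := by
        rw [e1]; exact intervalIntegral.norm_integral_le_integral_norm ht.1
      have e3 : ∫ s in a..t, (‖w s‖ + ‖w₁ s‖) = (∫ s in a..t, ‖w s‖) + ∫ s in a..t, ‖w₁ s‖ :=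
        intervalIntegral.integral_add (hwc.norm.intervalIntegrable _ _)
          (hw₁.norm.intervalIntegrable _ _)
      have p1 : 0 ≤ ∫ s in a..t, ‖w s‖ :=
        intervalIntegral.integral_nonneg ht.1 fun s _ => norm_nonneg _
      have p2 : 0 ≤ ∫ s in a..t, ‖w₁ s‖ :=
        intervalIntegral.integral_nonneg ht.1 fun s _ => norm_nonneg _
      rw [e3]
      have := h t ht
      nlinarith [mul_nonneg hM p2]) t ht
  calc ‖w t‖ ≤ ‖w t‖ + ‖w₁ t‖ := by linarith [norm_nonneg (w₁ t)]
    _ ≤ _ := this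
    _ ≤ _ := by
      refine mul_le_mul_of_nonneg_left (Real.exp_le_exp.2 ?_) hA
      exact mul_le_mul_of_nonneg_left (by linarith [ht.2]) (by linarith)

/-! ### Potentials and half-bound states -/

namespace IsPotential

variable {Φ : ℝ → ℝ}

theorem eq_zero (h : IsPotential Φ) {t : ℝ} (ht : 1 < |t|) : Φ t = 0 := by
  by_contra h0
  have := h.support_subset h0
  exact absurd (abs_le.2 this) (not_le.2 ht)

theorem exists_bound (h : IsPotential Φ) : ∃ M : ℝ, 0 ≤ M ∧ ∀ t, |Φ t| ≤ M := by
  obtain ⟨M, hM⟩ := h.bounded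
  exact ⟨M, (abs_nonneg _).trans (hM 0), hM⟩

theorem comp_neg (h : IsPotential Φ) : IsPotential fun t => Φ (-t) where
  aemeasurable := AEMeasurable.comp_quasiMeasurePreserving h.aemeasurable
    (Measure.measurePreserving_neg volume).quasiMeasurePreserving
  bounded := h.bounded.imp fun _ hM t => hM (-t)
  support_subset := fun t ht => by
    have := h.support_subset (show -t ∈ Function.support Φ from ht)
    exact ⟨by linarith [this.2], by linarith [this.1]⟩

theorem integrable (h : IsPotential Φ) : Integrable Φ := by
  obtain ⟨M, -, hM⟩ := h.exists_bound
  refine (integrableOn_iff_integrable_of_support_subset h.support_subset).1 ?_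
  exact Measure.integrableOn_of_bounded (by simp) h.aemeasurable.aestronglyMeasurable
    (Eventually.of_forall hM)

theorem intervalIntegrable_mul (h : IsPotential Φ) (α : ℝ) {u : ℝ → ℝ} (hu : Continuous u)
    (a b : ℝ) : IntervalIntegrable (fun t => α * Φ t * u t) volume a b :=
  ((h.integrable.const_mul α).intervalIntegrable).mul_continuousOn hu.continuousOn

end IsPotential

namespace IsHalfBoundState

variable {Φ : ℝ → ℝ} {α : ℝ} {u v : ℝ → ℝ}

theorem continuous (h : IsHalfBoundState Φ α u) : Continuous u := by
  obtain ⟨u₁, h1, -⟩ := h.solution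
  exact continuous_iff_continuousAt.2 fun t => (h1 t).continuousAt

theorem comp_neg (h : IsHalfBoundState Φ α u) :
    IsHalfBoundState (fun t => Φ (-t)) α fun t => u (-t) where
  solution := by
    obtain ⟨u₁, h1, h2⟩ := h.solution
    refine ⟨fun t => -u₁ (-t), fun t => ?_, fun a b => ?_⟩
    · have := (h1 (-t)).scomp t (hasDerivAt_neg t)
      simpa [Function.comp_def] using this
    · rw [intervalIntegral.integral_comp_neg (fun t => α * Φ t * u t), ← h2]
      ring
  bounded := h.bounded.imp fun _ hM t => hM (-t)
  nontrivial h0 := h.nontrivial (funext fun t => by simpa using congrFun h0 (-t))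

theorem sub (hΦ : IsPotential Φ) (h : IsHalfBoundState Φ α u) (k : IsHalfBoundState Φ α v)
    (hne : u ≠ v) : IsHalfBoundState Φ α fun t => u t - v t where
  solution := by
    obtain ⟨u₁, h1, h2⟩ := h.solution
    obtain ⟨v₁, k1, k2⟩ := k.solution
    refine ⟨fun t => u₁ t - v₁ t, fun t => (h1 t).sub (k1 t), fun a b => ?_⟩
    simp only [mul_sub]
    rw [intervalIntegral.integral_sub (hΦ.intervalIntegrable_mul α h.continuous a b)
      (hΦ.intervalIntegrable_mul α k.continuous a b), ← h2, ← k2]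
    ring
  bounded := by
    obtain ⟨M, hM⟩ := h.bounded
    obtain ⟨N, hN⟩ := k.bounded
    exact ⟨M + N, fun t => (abs_sub _ _).trans (add_le_add (hM t) (hN t))⟩
  nontrivial h0 := hne (funext fun t => sub_eq_zero.1 (congrFun h0 t))

theorem const_mul (h : IsHalfBoundState Φ α u) {c : ℝ} (hc : c ≠ 0) :
    IsHalfBoundState Φ α fun t => c * u t where
  solution := by
    obtain ⟨u₁, h1, h2⟩ := h.solution
    refine ⟨fun t => c * u₁ t, fun t => (h1 t).const_mul c, fun a b => ?_⟩
    rw [← mul_sub, h2, ← intervalIntegral.integral_const_mul]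
    refine intervalIntegral.integral_congr fun t _ => ?_
    ring
  bounded := by
    obtain ⟨M, hM⟩ := h.bounded
    exact ⟨|c| * M, fun t => by
      rw [abs_mul]; exact mul_le_mul_of_nonneg_left (hM t) (abs_nonneg c)⟩
  nontrivial h0 := h.nontrivial (funext fun t => by
    have := congrFun h0 t
    simpa [hc] using this)

/-- Left of the support of Φ the solution is affine, and a bounded affine function on a half-line
has slope 0. -/
theorem left_constant (hΦ : IsPotential Φ) (h : IsHalfBoundState Φ α u) :
    HasDerivAt u 0 (-1) ∧ ∀ t ≤ -1, u t = u (-1) := by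
  obtain ⟨u₁, h1, h2⟩ := h.solution
  have e1 : ∀ t ≤ -1, u₁ t = u₁ (-1) := fun t ht => by
    have : u₁ (-1) - u₁ t = 0 := by
      rw [h2]
      refine (intervalIntegral.integral_congr_ae (g := fun _ => (0 : ℝ)) ?_).trans (by simp)
      -- Φ need not vanish at the endpoint -1 itself.
      filter_upwards [compl_mem_ae_iff.2 (measure_singleton (-1 : ℝ))] with s hs hst
      rw [uIoc_of_le ht] at hst
      have : s < -1 := lt_of_le_of_ne hst.2 hs
      rw [hΦ.eq_zero (by rw [abs_of_neg (by linarith)]; linarith)]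
      simp
    linarith
  have e2 : ∀ t ≤ -1, u (-1) - u t = u₁ (-1) * (-1 - t) := fun t ht => by
    rw [← intervalIntegral.integral_eq_sub_of_hasDerivAt (f := u) (f' := u₁) (fun s _ => h1 s)]
    · rw [intervalIntegral.integral_congr (g := fun _ => u₁ (-1))]
      · simp [mul_comm]
      · intro s hs
        rw [uIcc_of_le ht] at hs
        exact e1 s hs.2
    · refine ContinuousOn.intervalIntegrable ((continuousOn_const (c := u₁ (-1))).congr ?_)
      intro s hs
      rw [uIcc_of_le ht] at hs
      exact e1 s hs.2
  obtain ⟨M, hM⟩ := h.bounded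
  have e3 : u₁ (-1) = 0 := by
    by_contra h0
    have hpos := abs_pos.2 h0
    -- At this distance a nonzero slope would change u by |2M + 1|, more than the 2M that the bound
    -- permits.
    have := e2 (-1 - (2 * M + 1) / |u₁ (-1)|) (by
      have : 0 ≤ M := (abs_nonneg _).trans (hM 0)
      have : 0 ≤ (2 * M + 1) / |u₁ (-1)| := by positivity
      linarith)
    have h3 := congrArg abs this
    rw [abs_mul, sub_sub_cancel, abs_div, abs_abs, mul_div_cancel₀ _ hpos.ne'] at h3
    have h4 := (abs_sub (u (-1)) (u (-1 - (2 * M + 1) / |u₁ (-1)|))).trans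
      (add_le_add (hM _) (hM _))
    have := le_abs_self (2 * M + 1)
    linarith
  refine ⟨e3 ▸ h1 (-1), fun t ht => ?_⟩
  have := e2 t ht
  rw [e3, zero_mul] at this
  linarith

theorem right_constant (hΦ : IsPotential Φ) (h : IsHalfBoundState Φ α u) :
    HasDerivAt u 0 1 ∧ ∀ t ≥ 1, u t = u 1 := by
  obtain ⟨h1, h2⟩ := h.comp_neg.left_constant hΦ.comp_neg
  constructor
  · have := h1.scomp_of_eq 1 (hasDerivAt_neg (1 : ℝ)) rfl
    simpa [Function.comp_def] using this
  · intro t ht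
    simpa using h2 (-t) (by linarith)

theorem exists_continuous_deriv (hΦ : IsPotential Φ) (h : IsHalfBoundState Φ α u) :
    ∃ u₁ : ℝ → ℝ, (∀ t, HasDerivAt u (u₁ t) t) ∧ Continuous u₁ ∧
      (∀ a b, u₁ b - u₁ a = ∫ t in a..b, α * Φ t * u t) ∧ u₁ (-1) = 0 ∧ u₁ 1 = 0 := by
  obtain ⟨u₁, h1, h2⟩ := h.solution
  refine ⟨u₁, h1, ?_, h2, (h1 (-1)).unique (h.left_constant hΦ).1,
    (h1 1).unique (h.right_constant hΦ).1⟩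
  have : u₁ = fun t => u₁ 0 + ∫ s in (0 : ℝ)..t, α * Φ s * u s := by
    funext t; rw [← h2]; ring
  rw [this]
  exact continuous_const.add (intervalIntegral.continuous_primitive
    (hΦ.intervalIntegrable_mul α h.continuous) 0)

/-- The derivative at -1 is 0, so a zero value there means zero Cauchy data. Grönwall with A = 0
then makes u vanish on [-1, 1], and constancy outside makes it vanish everywhere. -/
theorem apply_neg_one_ne_zero (hΦ : IsPotential Φ) (h : IsHalfBoundState Φ α u) : u (-1) ≠ 0 := by
  intro h0
  have l2 := (h.left_constant hΦ).2
  have r2 := (h.right_constant hΦ).2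
  obtain ⟨u₁, h1, hc, h2, hu₁, -⟩ := h.exists_continuous_deriv hΦ
  obtain ⟨M, hM0, hM⟩ := hΦ.exists_bound
  have key := norm_le_of_second_order (w := fun t => (u t : ℂ)) (w₁ := fun t => (u₁ t : ℂ))
    (fun t => (h1 t).ofReal_comp) (by fun_prop) (a := -1) (b := 1) (A := 0) (M := |α| * M)
    le_rfl (by positivity) (by simp [h0]) (fun t ht => by
      have e : u₁ t = ∫ s in (-1 : ℝ)..t, α * Φ s * u s := by rw [← h2, hu₁, sub_zero]
      rw [zero_add, Complex.norm_real, e, ← intervalIntegral.integral_const_mul]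
      refine intervalIntegral.norm_integral_le_of_norm_le ht.1
        (Eventually.of_forall fun s _ => ?_)
        (by have := h.continuous; exact (by fun_prop : Continuous _).intervalIntegrable _ _)
      rw [norm_mul, norm_mul, Complex.norm_real, Real.norm_eq_abs α, Real.norm_eq_abs (Φ s)]
      exact mul_le_mul_of_nonneg_right
        (mul_le_mul_of_nonneg_left (hM s) (abs_nonneg α)) (norm_nonneg _))
  have hz : ∀ t ∈ Icc (-1 : ℝ) 1, u t = 0 := fun t ht => by
    have := key t ht
    rw [zero_mul] at this
    simpa using norm_le_zero_iff.1 this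
  refine h.nontrivial (funext fun t => ?_)
  rcases le_total t (-1) with ht | ht
  · rw [l2 t ht, h0]; rfl
  rcases le_total t 1 with ht' | ht'
  · exact hz t ⟨ht, ht'⟩
  · rw [r2 t ht']; exact hz 1 (by norm_num)

theorem apply_one_ne_zero (hΦ : IsPotential Φ) (h : IsHalfBoundState Φ α u) : u 1 ≠ 0 := by
  simpa using h.comp_neg.apply_neg_one_ne_zero hΦ.comp_neg

end IsHalfBoundState

/-- The difference of two distinct normalized states would be a half-bound state vanishing at -1. -/
theorem existsUnique_normalizedHalfBoundState {Φ : ℝ → ℝ} (hΦ : IsPotential Φ) {α : ℝ}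
    (hα : α ∈ resonantSet Φ) : ∃! u : ℝ → ℝ, IsNormalizedHalfBoundState Φ α u := by
  obtain ⟨u, hu⟩ := hα
  have h0 := hu.apply_neg_one_ne_zero hΦ
  refine ⟨fun t => (u (-1))⁻¹ * u t, ⟨hu.const_mul (inv_ne_zero h0), fun t ht => ?_⟩,
    fun v hv => ?_⟩
  · simp only [(hu.left_constant hΦ).2 t ht, inv_mul_cancel₀ h0]
  · by_contra hne
    refine (hv.1.sub hΦ (hu.const_mul (inv_ne_zero h0)) hne).apply_neg_one_ne_zero hΦ ?_
    rw [hv.2 _ le_rfl, inv_mul_cancel₀ h0, sub_self]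

theorem IsNormalizedHalfBoundState.theta_eq {Φ : ℝ → ℝ} {α : ℝ} {u : ℝ → ℝ}
    (h : IsNormalizedHalfBoundState Φ α u) : theta u = u 1 := by
  rw [theta, h.2 _ le_rfl, div_one]

/-! ### Transfer of Cauchy data across the scaled potential -/

namespace IsPotential

variable {Ψ : ℝ → ℝ}

/-- The `L¹`-normalized rescaling of a potential. -/
theorem integrable_rescale (h : IsPotential Ψ) {η : ℝ} (hη : 0 < η) :
    Integrable fun s => η⁻¹ * Ψ (s / η) :=
  (h.integrable.comp_div hη.ne').const_mul _

theorem integral_abs_rescale_le (h : IsPotential Ψ) {η : ℝ} (hη : 0 < η) :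
    ∫ s in (-1 : ℝ)..1, |η⁻¹ * Ψ (s / η)| ≤ ∫ t, |Ψ t| := by
  have e : ∫ s, |η⁻¹ * Ψ (s / η)| = ∫ t, |Ψ t| := by
    simp only [abs_mul, abs_inv, abs_of_pos hη]
    rw [integral_const_mul, Measure.integral_comp_div (fun t => |Ψ t|), abs_of_pos hη,
      smul_eq_mul, inv_mul_cancel_left₀ hη.ne']
  rw [← e, intervalIntegral.integral_of_le (by norm_num)]
  exact setIntegral_le_integral (h.integrable_rescale hη).abs
    (Eventually.of_forall fun s => abs_nonneg _)

theorem integral_rescale (h : IsPotential Ψ) {η : ℝ} (hη : 0 < η) (hη1 : η < 1) :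
    ∫ s in (-1 : ℝ)..1, η⁻¹ * Ψ (s / η) = ∫ t, Ψ t := by
  rw [intervalIntegral.integral_const_mul, intervalIntegral.integral_comp_div _ hη.ne',
    smul_eq_mul, inv_mul_cancel_left₀ hη.ne']
  refine intervalIntegral.integral_eq_integral_of_support_subset (h.support_subset.trans ?_)
  -- The strict inequality is needed: the interval of integration is open on the left, and Ψ may be
  -- nonzero at -1.
  have : 1 < 1 / η := by rw [lt_div_iff₀ hη]; linarith
  intro t ht
  exact ⟨by rw [neg_div]; linarith [ht.1], by linarith [ht.2]⟩

theorem rescale_eq_zero (h : IsPotential Ψ) {η s : ℝ} (hη : 0 < η) (hs : η < |s|) :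
    Ψ (s / η) = 0 :=
  h.eq_zero (by rwa [abs_div, abs_of_pos hη, one_lt_div hη])

end IsPotential

/-- The rescaled potential perturbation: a short range spike and the spectral term. -/
noncomputable def rescaledPerturbation (Ψ : ℝ → ℝ) (β ε η : ℝ) (z : ℂ) (s : ℝ) : ℂ :=
  ((β * (η⁻¹ * Ψ (s / η)) : ℝ) : ℂ) - ε * z

theorem rescaledPerturbation_intervalIntegrable {Ψ : ℝ → ℝ} (hΨ : IsPotential Ψ) (β ε : ℝ) {η : ℝ}
    (hη : 0 < η) (z : ℂ) (a b : ℝ) :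
    IntervalIntegrable (rescaledPerturbation Ψ β ε η z) volume a b :=
  (((hΨ.integrable_rescale hη).const_mul β).ofReal.intervalIntegrable).sub
    intervalIntegrable_const

theorem integral_norm_rescaledPerturbation_le {Ψ : ℝ → ℝ} (hΨ : IsPotential Ψ) (β : ℝ) {ε η : ℝ}
    (hε : 0 < ε) (hε1 : ε ≤ 1) (hη : 0 < η) (z : ℂ) :
    ∫ s in (-1 : ℝ)..1, ‖rescaledPerturbation Ψ β ε η z s‖ ≤ |β| * (∫ t, |Ψ t|) + 2 * ‖z‖ := by
  have i := (hΨ.integrable_rescale hη).abs.intervalIntegrable (a := -1) (b := 1)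
  have e : ∫ s in (-1 : ℝ)..1, (|β| * |η⁻¹ * Ψ (s / η)| + ‖z‖) =
      |β| * (∫ s in (-1 : ℝ)..1, |η⁻¹ * Ψ (s / η)|) + 2 * ‖z‖ := by
    rw [intervalIntegral.integral_add (i.const_mul _) intervalIntegrable_const,
      intervalIntegral.integral_const_mul, intervalIntegral.integral_const, smul_eq_mul]
    ring
  refine le_trans ?_ (add_le_add_left (mul_le_mul_of_nonneg_left
    (hΨ.integral_abs_rescale_le hη) (abs_nonneg β)) _)
  rw [← e]
  refine intervalIntegral.integral_mono_on (by norm_num)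
    (rescaledPerturbation_intervalIntegrable hΨ β ε hη z _ _).norm
    ((i.const_mul _).add intervalIntegrable_const) fun s _ => ?_
  refine (norm_sub_le _ _).trans (add_le_add ?_ ?_)
  · rw [Complex.norm_real, norm_mul, Real.norm_eq_abs, Real.norm_eq_abs]
  · rw [norm_mul, Complex.norm_real, Real.norm_of_nonneg hε.le]
    exact mul_le_of_le_one_left (norm_nonneg _) hε1

/-- `v` solves the rescaled equation `v'' = (α Φ + ε q) v + r` on `[-1, 1]`, with Cauchy data at
`-1` of sizes `B` and `ε B`, and with a source term of size `ε^{3/2} B`. -/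
structure IsRescaledSolution (Φ Ψ : ℝ → ℝ) (α β : ℝ) (z : ℂ) (ε η B : ℝ) (v v₁ r : ℝ → ℂ) :
    Prop where
  nonneg : 0 ≤ B
  hasDerivAt : ∀ t, HasDerivAt v (v₁ t) t
  continuous_one : Continuous v₁
  source_integrable : IntervalIntegrable r volume (-1) 1
  sub_eq_integral : ∀ t ∈ Icc (-1 : ℝ) 1, v₁ t - v₁ (-1) = ∫ s in (-1 : ℝ)..t,
    (((α * Φ s : ℝ) : ℂ) * v s + ε * (rescaledPerturbation Ψ β ε η z s * v s) + r s)
  initial_le : ‖v (-1)‖ ≤ B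
  initial_one_le : ‖v₁ (-1)‖ ≤ ε * B
  source_le : ∫ s in (-1 : ℝ)..1, ‖r s‖ ≤ ε * √ε * B

/-- The difference w = v - v(-1) u starts from w(-1) = 0 with slope O(εB). The spike in q is large
pointwise and bounded only in L¹, so Grönwall handles αΦ alone; ε q v is treated as a source,
estimated through the maximum of ‖w‖ and absorbed for small ε. -/
theorem IsRescaledSolution.norm_sub_le {Φ Ψ : ℝ → ℝ} (hΦ : IsPotential Φ) (hΨ : IsPotential Ψ)
    (α β : ℝ) {u : ℝ → ℝ} (hu : IsNormalizedHalfBoundState Φ α u) (z : ℂ) :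
    ∃ C ≥ 0, ∃ δ > 0, δ ≤ 1 ∧ ∀ ε η B : ℝ, 0 < ε → ε < δ → 0 < η → ∀ v v₁ r : ℝ → ℂ,
      IsRescaledSolution Φ Ψ α β z ε η B v v₁ r →
        ∀ t ∈ Icc (-1 : ℝ) 1, ‖v t - v (-1) * u t‖ ≤ C * ε * B := by
  obtain ⟨u₁, hu1, hu1c, hu2, hul, hur⟩ := hu.1.exists_continuous_deriv hΦ
  obtain ⟨U, hU⟩ := hu.1.bounded
  obtain ⟨M, hM0, hM⟩ := hΦ.exists_bound
  have huc := hu.1.continuous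
  have hum1 : u (-1) = 1 := hu.2 _ le_rfl
  have hU0 : 0 ≤ U := (abs_nonneg _).trans (hU 0)
  set P := ∫ t, |Ψ t| with hP
  have hP0 : 0 ≤ P := integral_nonneg fun t => abs_nonneg _
  set Q := |β| * P + 2 * ‖z‖ with hQ
  have hQ0 : 0 ≤ Q := by positivity
  set E := Real.exp ((|α| * M + 1) * (1 - -1)) with hE
  have hE0 : 0 < E := Real.exp_pos _
  set C₁ := 2 * E * (2 + Q * U) with hC₁
  have hC₁0 : 0 ≤ C₁ := by positivity
  -- The second bound on ε ensures ε Q E ≤ 1/2, so that the maximum S of ‖w‖ on the right can be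
  -- absorbed.
  refine ⟨C₁, hC₁0, min 1 (1 / (2 * (Q * E + 1))), by positivity, min_le_left _ _, ?_⟩
  rintro ε η B hε hεδ hη v v₁ r ⟨hB, hv, hv₁c, hr, hv2, hvB, hv₁B, hrB⟩
  have hε1 : ε < 1 := hεδ.trans_le (min_le_left _ _)
  have hεQ : ε * (Q * E) ≤ 1 / 2 := by
    have := hεδ.trans_le (min_le_right _ _)
    rw [lt_div_iff₀ (by positivity)] at this
    nlinarith
  have hsq1 : √ε ≤ 1 := Real.sqrt_le_one.2 hε1.le
  set q := rescaledPerturbation Ψ β ε η z with hq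
  have iq : IntervalIntegrable q volume (-1) 1 :=
    rescaledPerturbation_intervalIntegrable hΨ β ε hη z _ _
  have hqQ : ∫ s in (-1 : ℝ)..1, ‖q s‖ ≤ Q :=
    integral_norm_rescaledPerturbation_le hΨ β hε hε1.le hη z
  have hvc : Continuous v := continuous_iff_continuousAt.2 fun t => (hv t).continuousAt
  set w : ℝ → ℂ := fun t => v t - v (-1) * u t with hw
  set w₁ : ℝ → ℂ := fun t => v₁ t - v (-1) * u₁ t with hw₁
  have hwd : ∀ t, HasDerivAt w (w₁ t) t := fun t =>
    (hv t).sub ((hu1 t).ofReal_comp.const_mul _)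
  have hwc : Continuous w := continuous_iff_continuousAt.2 fun t => (hwd t).continuousAt
  have hw₁c : Continuous w₁ := by fun_prop
  have hw0 : w (-1) = 0 := by simp [hw, hum1]
  obtain ⟨t₀, ht₀, hmax⟩ := (isCompact_Icc (a := (-1 : ℝ)) (b := 1)).exists_isMaxOn
    ⟨0, by norm_num⟩ hwc.norm.continuousOn
  set S := ‖w t₀‖ with hS
  have hS0 : 0 ≤ S := norm_nonneg _
  have hwS : ∀ t ∈ Icc (-1 : ℝ) 1, ‖w t‖ ≤ S := fun t ht => hmax ht
  have hvS : ∀ t ∈ Icc (-1 : ℝ) 1, ‖v t‖ ≤ B * U + S := fun t ht => by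
    have : v t = v (-1) * u t + w t := by rw [hw]; ring
    rw [this]
    refine (norm_add_le _ _).trans (add_le_add ?_ (hwS t ht))
    rw [norm_mul, Complex.norm_real]
    exact mul_le_mul hvB (hU t) (norm_nonneg _) hB
  have sub {t : ℝ} (ht : t ∈ Icc (-1 : ℝ) 1) : uIcc (-1) t ⊆ uIcc (-1 : ℝ) 1 :=
    uIcc_subset_uIcc_left (by rwa [uIcc_of_le (by norm_num)])
  have iΦ (a b : ℝ) : IntervalIntegrable (fun s => ((α * Φ s : ℝ) : ℂ)) volume a b :=
    (hΦ.integrable.const_mul α).ofReal.intervalIntegrable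
  have iΦv (a b : ℝ) : IntervalIntegrable (fun s => ((α * Φ s : ℝ) : ℂ) * v s) volume a b :=
    (iΦ a b).mul_continuousOn hvc.continuousOn
  have iqv : IntervalIntegrable (fun s => (ε : ℂ) * (q s * v s)) volume (-1) 1 :=
    (iq.mul_continuousOn hvc.continuousOn).const_mul _
  have hucplx (a b : ℝ) : (u₁ b : ℂ) - u₁ a = ∫ s in a..b, ((α * Φ s : ℝ) : ℂ) * u s := by
    rw [← Complex.ofReal_sub, hu2, ← intervalIntegral.integral_ofReal]
    simp only [Complex.ofReal_mul]
  have hucc : Continuous fun t => (u t : ℂ) := by fun_prop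
  -- The term 2εB collects the initial slope and the source r, at most εB each.
  have hgron : ∀ t ∈ Icc (-1 : ℝ) 1, ‖w₁ t‖ ≤ (2 * ε * B + ε * (Q * (B * U + S))) +
      (|α| * M) * ∫ s in (-1 : ℝ)..t, ‖w s‖ := by
    intro t ht
    have i1 := iΦv (-1) t
    have i2 := iqv.mono_set (sub ht)
    have i3 := hr.mono_set (sub ht)
    have i4 : IntervalIntegrable (fun s => ((α * Φ s : ℝ) : ℂ) * w s) volume (-1) t :=
      (iΦ _ _).mul_continuousOn hwc.continuousOn
    have e : w₁ t = v₁ (-1) + (∫ s in (-1 : ℝ)..t, ((α * Φ s : ℝ) : ℂ) * w s) +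
        (∫ s in (-1 : ℝ)..t, (ε : ℂ) * (q s * v s)) + ∫ s in (-1 : ℝ)..t, r s := by
      have h1 := hv2 t ht
      rw [intervalIntegral.integral_add (i1.add i2) i3, intervalIntegral.integral_add i1 i2] at h1
      have h2 := hucplx (-1) t
      rw [hul] at h2
      have h3 : ∫ s in (-1 : ℝ)..t, ((α * Φ s : ℝ) : ℂ) * w s =
          (∫ s in (-1 : ℝ)..t, ((α * Φ s : ℝ) : ℂ) * v s) -
            v (-1) * ∫ s in (-1 : ℝ)..t, ((α * Φ s : ℝ) : ℂ) * u s := by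
        rw [← intervalIntegral.integral_const_mul, ← intervalIntegral.integral_sub i1
          (((iΦ _ _).mul_continuousOn hucc.continuousOn).const_mul _)]
        refine intervalIntegral.integral_congr fun s _ => ?_
        simp only [hw]; ring
      rw [h3, ← h2]
      simp only [hw₁, Complex.ofReal_zero, sub_zero]
      linear_combination h1
    have b1 : ‖∫ s in (-1 : ℝ)..t, ((α * Φ s : ℝ) : ℂ) * w s‖ ≤
        (|α| * M) * ∫ s in (-1 : ℝ)..t, ‖w s‖ := by
      rw [← intervalIntegral.integral_const_mul]
      refine intervalIntegral.norm_integral_le_of_norm_le ht.1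
        (Eventually.of_forall fun s _ => ?_)
        ((hwc.norm.const_mul _).intervalIntegrable _ _)
      rw [norm_mul, Complex.norm_real, norm_mul, Real.norm_eq_abs, Real.norm_eq_abs]
      exact mul_le_mul_of_nonneg_right
        (mul_le_mul_of_nonneg_left (hM s) (abs_nonneg α)) (norm_nonneg _)
    have b2 : ‖∫ s in (-1 : ℝ)..t, (ε : ℂ) * (q s * v s)‖ ≤ ε * (Q * (B * U + S)) := by
      have : ∫ s in (-1 : ℝ)..t, ε * (‖q s‖ * (B * U + S)) ≤ ε * (Q * (B * U + S)) := by
        rw [intervalIntegral.integral_const_mul, intervalIntegral.integral_mul_const]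
        refine mul_le_mul_of_nonneg_left (mul_le_mul_of_nonneg_right (le_trans ?_ hqQ)
          (by positivity)) hε.le
        exact intervalIntegral.integral_mono_interval le_rfl ht.1 ht.2
          (Eventually.of_forall fun s => norm_nonneg _) iq.norm
      refine le_trans (intervalIntegral.norm_integral_le_of_norm_le ht.1
        (Eventually.of_forall fun s hs => ?_)
        (((iq.mono_set (sub ht)).norm.mul_const _).const_mul _)) this
      rw [norm_mul, norm_mul, Complex.norm_real, Real.norm_of_nonneg hε.le]
      exact mul_le_mul_of_nonneg_left (mul_le_mul_of_nonneg_left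
        (hvS s ⟨hs.1.le, hs.2.trans ht.2⟩) (norm_nonneg _)) hε.le
    have b3 : ‖∫ s in (-1 : ℝ)..t, r s‖ ≤ ε * B := by
      refine (intervalIntegral.norm_integral_le_integral_norm ht.1).trans ?_
      refine (intervalIntegral.integral_mono_interval le_rfl ht.1 ht.2
          (Eventually.of_forall fun s => norm_nonneg _) hr.norm).trans (hrB.trans ?_)
      exact mul_le_mul_of_nonneg_right (mul_le_of_le_one_right hε.le hsq1) hB
    rw [e]
    have n1 := norm_add_le (v₁ (-1) + (∫ s in (-1 : ℝ)..t, ((α * Φ s : ℝ) : ℂ) * w s) +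
        (∫ s in (-1 : ℝ)..t, (ε : ℂ) * (q s * v s))) (∫ s in (-1 : ℝ)..t, r s)
    have n2 := norm_add_le (v₁ (-1) + (∫ s in (-1 : ℝ)..t, ((α * Φ s : ℝ) : ℂ) * w s))
        (∫ s in (-1 : ℝ)..t, (ε : ℂ) * (q s * v s))
    have n3 := norm_add_le (v₁ (-1)) (∫ s in (-1 : ℝ)..t, ((α * Φ s : ℝ) : ℂ) * w s)
    linarith
  have hSC : S ≤ C₁ * ε * B := by
    have h1 := norm_le_of_second_order hwd hw₁c (a := -1) (b := 1) (by positivity)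
      (by positivity) hw0 hgron t₀ ht₀
    rw [← hE, ← hS] at h1
    -- The S-term is at most S/2; moving it to the left doubles the rest, which is the factor 2 in
    -- C₁.
    have h2 : (2 * ε * B + ε * (Q * (B * U + S))) * E =
        ε * E * (2 + Q * U) * B + ε * (Q * E) * S := by ring
    have h3 := mul_le_mul_of_nonneg_right hεQ hS0
    rw [hC₁]
    linarith
  exact fun t ht => (hwS t ht).trans hSC

/-- Collects the errors of the spike, the spectral term and the source under the common rate ε(√ε +
η), using ε ≤ √ε for ε ≤ 1. -/
theorem transfer_constant_le {ε η B b U U₁ C Z : ℝ} (hε : 0 ≤ ε) (hε1 : ε ≤ 1)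
    (hη : 0 ≤ η) (hB : 0 ≤ B) (hb : 0 ≤ b) (hU : 0 ≤ U) (hU₁ : 0 ≤ U₁) (hC : 0 ≤ C) (hZ : 0 ≤ Z) :
    ε * b * (C * ε * B * U + B * (2 * U * U₁ * η)) + 2 * (ε ^ 2 * Z * ((U + C) * B * U)) +
        ε * √ε * B * U ≤
      (b * (C * U) + b * (2 * U * U₁) + 2 * Z * ((U + C) * U) + U) * ε * (√ε + η) * B := by
  have hsqε : ε ≤ √ε := Real.le_sqrt_of_sq_le (by nlinarith)
  have h1 : b * (C * U) * ε ≤ b * (C * U) * (√ε + η) := by gcongr; linarith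
  have h2 : b * (2 * U * U₁) * η ≤ b * (2 * U * U₁) * (√ε + η) := by
    gcongr; linarith [Real.sqrt_nonneg ε]
  have h3 : 2 * Z * ((U + C) * U) * ε ≤ 2 * Z * ((U + C) * U) * (√ε + η) := by
    gcongr; linarith
  have h4 : U * √ε ≤ U * (√ε + η) := by gcongr; linarith
  have h5 := mul_le_mul_of_nonneg_left (add_le_add (add_le_add (add_le_add h1 h2) h3) h4)
    (mul_nonneg hε hB)
  linarith

/-- The value at 1 comes from v ≈ v(-1) u. That approximation says nothing precise enough about
v'(1), which is of order ε; it is read off the Wronskian of v and u instead. There αΦ cancels, and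
u'(±1) = 0 removes the terms with v(±1). -/
theorem IsRescaledSolution.transfer {Φ Ψ : ℝ → ℝ} (hΦ : IsPotential Φ) (hΨ : IsPotential Ψ)
    (α β : ℝ) {u : ℝ → ℝ} (hu : IsNormalizedHalfBoundState Φ α u) (z : ℂ) :
    ∃ C > 0, ∃ δ > 0, δ ≤ 1 ∧ ∀ ε η B : ℝ, 0 < ε → ε < δ → 0 < η → η < 1 → ∀ v v₁ r : ℝ → ℂ,
      IsRescaledSolution Φ Ψ α β z ε η B v v₁ r →
        (∀ t ∈ Icc (-1 : ℝ) 1, ‖v t‖ ≤ C * B) ∧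
        ‖v 1 - theta u * v (-1)‖ ≤ C * ε * B ∧
        ‖theta u * v₁ 1 - v₁ (-1) - ε * (β * (u 0 ^ 2 * ∫ t, Ψ t) : ℝ) * v (-1)‖ ≤
          C * ε * (√ε + η) * B := by
  obtain ⟨C₁, hC₁0, δ, hδ, hδ1, hA⟩ := IsRescaledSolution.norm_sub_le hΦ hΨ α β hu z
  obtain ⟨u₁, hu1, hu1c, hu2, hul, hur⟩ := hu.1.exists_continuous_deriv hΦ
  obtain ⟨U, hU⟩ := hu.1.bounded
  have huc := hu.1.continuous
  have hum1 : u (-1) = 1 := hu.2 _ le_rfl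
  have hU0 : 0 ≤ U := (abs_nonneg _).trans (hU 0)
  obtain ⟨U₁, hU₁⟩ := (isCompact_Icc (a := (-1 : ℝ)) (b := 1)).exists_bound_of_continuousOn
    hu1c.continuousOn
  have hU₁0 : 0 ≤ U₁ := (norm_nonneg _).trans (hU₁ 0 (by norm_num))
  set P := ∫ t, |Ψ t| with hP
  have hP0 : 0 ≤ P := integral_nonneg fun t => abs_nonneg _
  set C₂ := |β| * P * (C₁ * U) + |β| * P * (2 * U * U₁) + 2 * ‖z‖ * ((U + C₁) * U) + U with hC₂
  have hC₂0 : 0 ≤ C₂ := by positivity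
  refine ⟨U + C₁ + C₂ + 1, by positivity, δ, hδ, hδ1, ?_⟩
  intro ε η B hε hεδ hη hη1 v v₁ r hvr
  have hwS := hA ε η B hε hεδ hη v v₁ r hvr
  obtain ⟨hB, hv, hv₁c, hr, hv2, hvB, -, hrB⟩ := hvr
  have hε1 : ε < 1 := hεδ.trans_le hδ1
  set q := rescaledPerturbation Ψ β ε η z with hq
  have iq : IntervalIntegrable q volume (-1) 1 :=
    rescaledPerturbation_intervalIntegrable hΨ β ε hη z _ _
  have hvc : Continuous v := continuous_iff_continuousAt.2 fun t => (hv t).continuousAt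
  have iΦ (a b : ℝ) : IntervalIntegrable (fun s => ((α * Φ s : ℝ) : ℂ)) volume a b :=
    (hΦ.integrable.const_mul α).ofReal.intervalIntegrable
  have iΦv (a b : ℝ) : IntervalIntegrable (fun s => ((α * Φ s : ℝ) : ℂ) * v s) volume a b :=
    (iΦ a b).mul_continuousOn hvc.continuousOn
  have iqv : IntervalIntegrable (fun s => (ε : ℂ) * (q s * v s)) volume (-1) 1 :=
    (iq.mul_continuousOn hvc.continuousOn).const_mul _
  have hucplx (a b : ℝ) : (u₁ b : ℂ) - u₁ a = ∫ s in a..b, ((α * Φ s : ℝ) : ℂ) * u s := by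
    rw [← Complex.ofReal_sub, hu2, ← intervalIntegral.integral_ofReal]
    simp only [Complex.ofReal_mul]
  have hucc : Continuous fun t => (u t : ℂ) := by fun_prop
  have hvC : ∀ t ∈ Icc (-1 : ℝ) 1, ‖v t‖ ≤ (U + C₁) * B := fun t ht => by
    have h1 : C₁ * ε * B ≤ C₁ * B :=
      mul_le_mul_of_nonneg_right (mul_le_of_le_one_right hC₁0 hε1.le) hB
    have h2 : ‖v (-1) * u t‖ ≤ B * U := by
      rw [norm_mul, Complex.norm_real]
      exact mul_le_mul hvB (hU t) (norm_nonneg _) hB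
    have h3 := norm_add_le (v t - v (-1) * u t) (v (-1) * u t)
    rw [sub_add_cancel] at h3
    linarith [hwS t ht]
  refine ⟨fun t ht => (hvC t ht).trans (mul_le_mul_of_nonneg_right (by linarith) hB), ?_, ?_⟩
  · have h1 : v 1 - theta u * v (-1) = v 1 - v (-1) * u 1 := by rw [hu.theta_eq]; ring
    rw [h1]
    refine (hwS 1 (by norm_num)).trans ?_
    exact mul_le_mul_of_nonneg_right (mul_le_mul_of_nonneg_right (by linarith) hε.le) hB
  have ivv : IntervalIntegrable (fun s => ((α * Φ s : ℝ) : ℂ) * v s + ε * (q s * v s) + r s)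
      volume (-1) 1 := ((iΦv _ _).add iqv).add hr
  have iΦu : IntervalIntegrable (fun s => ((α * Φ s : ℝ) : ℂ) * u s) volume (-1) 1 :=
    (iΦ _ _).mul_continuousOn hucc.continuousOn
  have hu1cc : Continuous fun t => (u₁ t : ℂ) := by fun_prop
  have huI : uIcc (-1 : ℝ) 1 = Icc (-1) 1 := uIcc_of_le (by norm_num)
  have g1 := mul_sub_mul_eq_integral_of_primitive (F := v₁) (G := fun t => (u t : ℂ)) ivv
    (hu1cc.intervalIntegrable (-1) 1) (fun t ht => hv2 t (huI ▸ ht)) (fun t _ =>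
      (intervalIntegral.integral_eq_sub_of_hasDerivAt (fun s _ => (hu1 s).ofReal_comp)
        (hu1cc.intervalIntegrable _ _)).symm)
  have g2 := mul_sub_mul_eq_integral_of_primitive (F := v) (G := fun t => (u₁ t : ℂ))
    (hv₁c.intervalIntegrable (-1) 1) iΦu (fun t _ =>
      (intervalIntegral.integral_eq_sub_of_hasDerivAt (fun s _ => hv s)
        (hv₁c.intervalIntegrable _ _)).symm) (fun t _ => hucplx (-1) t)
  set k : ℝ → ℝ := fun s => η⁻¹ * Ψ (s / η) with hk
  have ik : IntervalIntegrable k volume (-1) 1 :=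
    (hΨ.integrable_rescale hη).intervalIntegrable
  have ikc : IntervalIntegrable (fun s => (k s : ℂ)) volume (-1) 1 :=
    (hΨ.integrable_rescale hη).ofReal.intervalIntegrable
  have ik2 : ∫ s in (-1 : ℝ)..1, (k s : ℂ) = ((∫ t, Ψ t : ℝ) : ℂ) := by
    rw [intervalIntegral.integral_ofReal, hΨ.integral_rescale hη hη1]
  -- K bounds v u - v(-1) u(0)² on the support of the spike: first v is replaced by v(-1) u, then
  -- u(s)² by u(0)².
  set K := C₁ * ε * B * U + B * (2 * U * U₁ * η) with hK
  have hK0 : 0 ≤ K := by positivity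
  -- The Wronskian identity, with the limiting term written as an integral against the same spike so
  -- that the two can be compared pointwise.
  have hkey : theta u * v₁ 1 - v₁ (-1) - ε * (β * (u 0 ^ 2 * ∫ t, Ψ t) : ℝ) * v (-1) =
      ∫ s in (-1 : ℝ)..1, ((ε * β : ℝ) * (k s * (v s * u s - v (-1) * (u 0 ^ 2 : ℝ))) -
        (ε ^ 2 : ℝ) * z * (v s * u s) + r s * u s) := by
    have j1 : IntervalIntegrable (fun s => (((α * Φ s : ℝ) : ℂ) * v s + ε * (q s * v s) + r s) *
        u s + v₁ s * u₁ s) volume (-1) 1 :=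
      (ivv.mul_continuousOn hucc.continuousOn).add
        ((hv₁c.mul hu1cc).intervalIntegrable _ _)
    have j2 : IntervalIntegrable (fun s => v₁ s * u₁ s + v s * (((α * Φ s : ℝ) : ℂ) * u s))
        volume (-1) 1 :=
      ((hv₁c.mul hu1cc).intervalIntegrable _ _).add (iΦu.continuousOn_mul hvc.continuousOn)
    have j3 : IntervalIntegrable (fun s => ((ε * β * u 0 ^ 2 : ℝ) * v (-1)) * (k s : ℂ))
        volume (-1) 1 := ikc.const_mul _
    have g3 : theta u * v₁ 1 - v₁ (-1) = (v₁ 1 * u 1 - v₁ (-1) * u (-1)) -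
        (v 1 * u₁ 1 - v (-1) * u₁ (-1)) := by
      rw [hu.theta_eq, hul, hur, hum1]; push_cast; ring
    have g4 : (ε : ℂ) * (β * (u 0 ^ 2 * ∫ t, Ψ t) : ℝ) * v (-1) =
        ∫ s in (-1 : ℝ)..1, ((ε * β * u 0 ^ 2 : ℝ) * v (-1)) * (k s : ℂ) := by
      rw [intervalIntegral.integral_const_mul, ik2]; push_cast; ring
    rw [g3, g1, g2, g4, ← intervalIntegral.integral_sub j1 j2,
      ← intervalIntegral.integral_sub (j1.sub j2) j3]
    refine intervalIntegral.integral_congr fun s _ => ?_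
    simp only [hq, rescaledPerturbation, hk]
    push_cast
    ring
  have hbd : ∀ s ∈ Ioc (-1 : ℝ) 1,
      ‖(((ε * β : ℝ) * (k s * (v s * u s - v (-1) * (u 0 ^ 2 : ℝ))) -
        (ε ^ 2 : ℝ) * z * (v s * u s) + r s * u s : ℂ))‖ ≤
      (ε * |β| * K) * |k s| + ε ^ 2 * ‖z‖ * ((U + C₁) * B * U) + ‖r s‖ * U := by
    intro s hs
    have hs' := Ioc_subset_Icc_self hs
    refine (norm_add_le _ _).trans (add_le_add ((_root_.norm_sub_le _ _).trans (add_le_add ?_ ?_)) ?_)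
    · rw [norm_mul, norm_mul, Complex.norm_real, Complex.norm_real, norm_mul,
        Real.norm_of_nonneg hε.le, Real.norm_eq_abs, Real.norm_eq_abs]
      rcases lt_or_ge η |s| with hsη | hsη
      · have : k s = 0 := by simp only [hk, hΨ.rescale_eq_zero hη hsη, mul_zero]
        rw [this]; simp
      have hdu : |u s - u 0| ≤ U₁ * |s| := by
        have := (convex_Icc (-1 : ℝ) 1).norm_image_sub_le_of_norm_hasDerivWithin_le
          (f := u) (f' := u₁) (C := U₁) (x := 0) (y := s)
          (fun x _ => (hu1 x).hasDerivWithinAt) hU₁ (by norm_num) hs'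
        simpa using this
      have hdu2 : |u s ^ 2 - u 0 ^ 2| ≤ 2 * U * U₁ * η := by
        have e : u s ^ 2 - u 0 ^ 2 = (u s - u 0) * (u s + u 0) := by ring
        have h1 : |u s + u 0| ≤ 2 * U := (abs_add_le _ _).trans (by linarith [hU s, hU 0])
        rw [e, abs_mul]
        calc |u s - u 0| * |u s + u 0| ≤ (U₁ * η) * (2 * U) :=
              mul_le_mul (hdu.trans (mul_le_mul_of_nonneg_left hsη hU₁0)) h1 (abs_nonneg _)
                (by positivity)
          _ = _ := by ring
      have hd : ‖v s * u s - v (-1) * (u 0 ^ 2 : ℝ)‖ ≤ K := by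
        have e : v s * u s - v (-1) * (u 0 ^ 2 : ℝ) =
            (v s - v (-1) * u s) * u s + v (-1) * ((u s ^ 2 - u 0 ^ 2 : ℝ) : ℂ) := by
          push_cast; ring
        rw [e]
        refine (norm_add_le _ _).trans (add_le_add ?_ ?_)
        · rw [norm_mul, Complex.norm_real]
          exact mul_le_mul (hwS s hs') (hU s) (norm_nonneg _) (by positivity)
        · rw [norm_mul, Complex.norm_real]
          exact mul_le_mul hvB hdu2 (norm_nonneg _) hB
      calc ε * |β| * (|k s| * ‖v s * u s - v (-1) * (u 0 ^ 2 : ℝ)‖)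
          ≤ ε * |β| * (|k s| * K) := by gcongr
        _ = _ := by ring
    · rw [norm_mul, norm_mul, norm_mul, Complex.norm_real, Complex.norm_real,
        Real.norm_of_nonneg (by positivity)]
      exact mul_le_mul_of_nonneg_left (mul_le_mul (hvC s hs') (hU s) (norm_nonneg _)
        (by positivity)) (by positivity)
    · rw [norm_mul, Complex.norm_real]
      exact mul_le_mul_of_nonneg_left (hU s) (norm_nonneg _)
  rw [hkey]
  refine (intervalIntegral.norm_integral_le_of_norm_le (by norm_num)
    (Eventually.of_forall hbd) (((ik.abs.const_mul _).add intervalIntegrable_const).add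
      (hr.norm.mul_const _))).trans ?_
  rw [intervalIntegral.integral_add ((ik.abs.const_mul _).add intervalIntegrable_const)
      (hr.norm.mul_const _), intervalIntegral.integral_add (ik.abs.const_mul _)
      intervalIntegrable_const, intervalIntegral.integral_const, smul_eq_mul,
    intervalIntegral.integral_const_mul, intervalIntegral.integral_mul_const]
  have f1 : ε * |β| * K * (∫ s in (-1 : ℝ)..1, |k s|) ≤ ε * |β| * K * P :=
    mul_le_mul_of_nonneg_left (hΨ.integral_abs_rescale_le hη) (by positivity)
  have f2 := mul_le_mul_of_nonneg_right hrB hU0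
  have f3 := transfer_constant_le (b := |β| * P) (U₁ := U₁) hε.le hε1.le hη.le hB (by positivity)
    hU0 hU₁0 hC₁0 (norm_nonneg z)
  rw [← hK, ← hC₂] at f3
  have f4 : C₂ * ε * (√ε + η) * B ≤ (U + C₁ + C₂ + 1) * ε * (√ε + η) * B := by
    gcongr; linarith
  linarith

/-! ### Solutions of the resolvent equation -/

theorem lpNorm_comp_neg {φ : ℝ → ℂ} {s : Set ℝ}
    (h : AEStronglyMeasurable φ (volume.restrict s)) :
    lpNorm (fun x => φ (-x)) 2 (volume.restrict (Neg.neg ⁻¹' s)) =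
      lpNorm φ 2 (volume.restrict s) := by
  have hp := (Measure.measurePreserving_neg (volume : Measure ℝ)).restrict_preimage_emb
    (Homeomorph.neg ℝ).measurableEmbedding s
  have := eLpNorm_comp_measurePreserving (p := 2) h hp
  rw [← toReal_eLpNorm h, ← this]
  exact (toReal_eLpNorm (h.comp_measurePreserving hp)).symm

namespace IsW22

variable {Ω : Set ℝ} {φ φ₁ φ₂ f : ℝ → ℂ} {z : ℂ} {c : ℝ}

theorem lpNorm_two_le (h : IsW22 Ω φ φ₁ φ₂) {s : Set ℝ} (hs : s ⊆ Ω)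
    (he : ∀ᵐ x ∂volume.restrict s, φ₂ x = -z * φ x - f x) :
    lpNorm φ₂ 2 (volume.restrict s) ≤
      ‖z‖ * lpNorm φ 2 (volume.restrict s) + lpNorm f 2 (volume.restrict s) := by
  have hm : MemLp φ 2 (volume.restrict s) := h.memLp.mono_measure (Measure.restrict_mono hs le_rfl)
  rw [lpNorm_congr_ae' he]
  refine (lpNorm_sub_le (f := (-z) • φ) (hm.const_smul (-z)) (by norm_num)).trans_eq ?_
  rw [lpNorm_const_smul]
  simp

theorem norm_le_right (h : IsW22 Ω φ φ₁ φ₂) (hc : Icc c (c + 1) ⊆ Ω)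
    (he : ∀ᵐ x, x ∈ Ioo c (c + 1) → φ₂ x = -z * φ x - f x) :
    ‖φ c‖ ≤ 12 * ((1 + ‖z‖) * lpNorm φ 2 (volume.restrict (Ioo c (c + 1))) +
      lpNorm f 2 (volume.restrict (Ioo c (c + 1)))) ∧
    ‖φ₁ c‖ ≤ 12 * ((1 + ‖z‖) * lpNorm φ 2 (volume.restrict (Ioo c (c + 1))) +
      lpNorm f 2 (volume.restrict (Ioo c (c + 1)))) := by
  have h1 := h.norm_le hc
  rw [← Measure.restrict_congr_set Ioo_ae_eq_Ioc] at h1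
  have h2 := h.lpNorm_two_le (Ioo_subset_Icc_self.trans hc)
    ((ae_restrict_iff' measurableSet_Ioo).2 he)
  constructor <;> linarith [h1.1, h1.2]

theorem norm_le_left (h : IsW22 Ω φ φ₁ φ₂) (hf : MemLp f 2 volume) (hc : Icc (c - 1) c ⊆ Ω)
    (he : ∀ᵐ x, x ∈ Ioo (c - 1) c → φ₂ x = -z * φ x - f x) :
    ‖φ c‖ ≤ 12 * ((1 + ‖z‖) * lpNorm φ 2 (volume.restrict (Ioo (c - 1) c)) +
      lpNorm f 2 (volume.restrict (Ioo (c - 1) c))) ∧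
    ‖φ₁ c‖ ≤ 12 * ((1 + ‖z‖) * lpNorm φ 2 (volume.restrict (Ioo (c - 1) c)) +
      lpNorm f 2 (volume.restrict (Ioo (c - 1) c))) := by
  have hn := Measure.measurePreserving_neg (volume : Measure ℝ)
  have key := h.comp_neg.norm_le_right (c := -c) (f := fun x => f (-x)) (z := z)
    (fun x hx => hc ⟨by linarith [hx.2], by linarith [hx.1]⟩)
    ((hn.quasiMeasurePreserving.ae he).mono fun x hx hx' =>
      hx ⟨by linarith [hx'.2], by linarith [hx'.1]⟩)
  have hpre : Ioo (-c) (-c + 1) = Neg.neg ⁻¹' Ioo (c - 1) c := by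
    ext x; simp only [mem_Ioo, mem_preimage]; constructor <;> intro h <;>
      constructor <;> linarith [h.1, h.2]
  rw [hpre, lpNorm_comp_neg (h.mono (Ioo_subset_Icc_self.trans hc)).memLp.1] at key
  have := lpNorm_comp_neg (s := Ioo (c - 1) c)
    (hf.1.mono_measure (Measure.restrict_le_self (s := Ioo (c - 1) c)))
  rw [this] at key
  simpa using key

/-- The derivative φ₁ is bounded, so φ moves by O(ε). The second derivative is controlled only in
L², and Cauchy-Schwarz gives φ₁ the weaker O(√ε), one source of the exponent 1/2 in the rate. -/
theorem norm_sub_limit_right (h : IsW22 Ω φ φ₁ φ₂) {ε B : ℝ} (hε : 0 < ε) (hΩ : Ioc 0 ε ⊆ Ω)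
    {l m : ℂ} (hl : Tendsto φ (𝓝[>] 0) (𝓝 l)) (hm : Tendsto φ₁ (𝓝[>] 0) (𝓝 m))
    (hB : ∀ x ∈ Ioc 0 ε, ‖φ₁ x‖ ≤ B) (hB2 : lpNorm φ₂ 2 (volume.restrict (Ioc 0 ε)) ≤ B) :
    ‖φ ε - l‖ ≤ ε * B ∧ ‖φ₁ ε - m‖ ≤ √ε * B := by
  have hB0 : 0 ≤ B := lpNorm_nonneg.trans hB2
  have hmem : Ioo 0 ε ∈ 𝓝[>] (0 : ℝ) := Ioo_mem_nhdsGT hε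
  have hsub {s : ℝ} (hs : s ∈ Ioo 0 ε) : uIcc s ε ⊆ Ω := by
    rw [uIcc_of_le hs.2.le]
    exact fun x hx => hΩ ⟨hs.1.trans_le hx.1, hx.2⟩
  constructor
  · refine le_of_tendsto (tendsto_const_nhds.sub hl).norm ?_
    filter_upwards [hmem] with s hs
    rw [h.sub_eq_integral_one (hsub hs)]
    refine (intervalIntegral.norm_integral_le_of_norm_le_const (C := B) fun x hx => ?_).trans ?_
    · rw [uIoc_of_le hs.2.le] at hx
      exact hB x ⟨hs.1.trans hx.1, hx.2⟩
    · rw [abs_of_pos (sub_pos.2 hs.2), mul_comm]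
      exact mul_le_mul_of_nonneg_right (by linarith [hs.1]) hB0
  · refine le_of_tendsto (tendsto_const_nhds.sub hm).norm ?_
    filter_upwards [hmem] with s hs
    have hm0 := (h.mono hΩ).memLp_two
    have hle : volume.restrict (Ioc s ε) ≤ volume.restrict (Ioc 0 ε) :=
      Measure.restrict_mono (Ioc_subset_Ioc_left hs.1.le) le_rfl
    rw [h.sub_eq_integral _ _ (hsub hs)]
    refine (intervalIntegral.norm_integral_le_integral_norm hs.2.le).trans ?_
    refine (integral_norm_le_sqrt_mul_lpNorm hs.2.le (hm0.mono_measure hle)).trans ?_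
    exact mul_le_mul (Real.sqrt_le_sqrt (by linarith [hs.1]))
      ((hm0.lpNorm_mono_measure hle).trans hB2) lpNorm_nonneg (Real.sqrt_nonneg _)

theorem norm_sub_limit_left (h : IsW22 Ω φ φ₁ φ₂) {ε B : ℝ} (hε : 0 < ε) (hΩ : Ico (-ε) 0 ⊆ Ω)
    {l m : ℂ} (hl : Tendsto φ (𝓝[<] 0) (𝓝 l)) (hm : Tendsto φ₁ (𝓝[<] 0) (𝓝 m))
    (hB : ∀ x ∈ Ico (-ε) 0, ‖φ₁ x‖ ≤ B) (hB2 : lpNorm φ₂ 2 (volume.restrict (Ico (-ε) 0)) ≤ B) :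
    ‖φ (-ε) - l‖ ≤ ε * B ∧ ‖φ₁ (-ε) - m‖ ≤ √ε * B := by
  have hpre : Ioc 0 ε = Neg.neg ⁻¹' Ico (-ε) 0 := by
    ext x; simp only [mem_Ioc, mem_Ico, mem_preimage]; constructor <;> intro h <;>
      constructor <;> linarith [h.1, h.2]
  have hneg : Tendsto (fun x : ℝ => -x) (𝓝[>] 0) (𝓝[<] 0) := by
    simpa using tendsto_neg_nhdsGT_neg (a := (0 : ℝ))
  have key := h.comp_neg.norm_sub_limit_right (l := l) (m := -m) hε
    (fun x hx => hΩ (by rw [hpre] at hx; exact hx)) (hl.comp hneg) (hm.comp hneg).neg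
    (fun x hx => by rw [norm_neg]; exact hB _ (by rw [hpre] at hx; exact hx))
    (by rw [hpre, lpNorm_comp_neg (h.mono hΩ).memLp_two.1]; exact hB2)
  refine ⟨key.1, ?_⟩
  rw [← norm_neg, neg_sub]
  convert! key.2 using 2
  ring

/-- The energy estimate outside an interval: a solution of the free equation which nearly satisfies
symmetric interface conditions is small. -/
theorem exterior_le (h : IsW22 {0}ᶜ φ φ₁ φ₂) (hz : z.im ≠ 0) {ε θ κ e : ℝ} (hε : 0 < ε)
    (he : ∀ᵐ x, ε < |x| → φ₂ x = -z * φ x)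
    (h1 : ‖φ ε - θ * φ (-ε)‖ ≤ e) (h2 : ‖θ * φ₁ ε - φ₁ (-ε) - κ * φ (-ε)‖ ≤ e) :
    √((∫ x in Iic (-ε), ‖φ x‖ ^ 2) + ∫ x in Ioi ε, ‖φ x‖ ^ 2) ≤
      24 * (1 + ‖z‖) / |z.im| * e := by
  set X := (∫ x in Iic (-ε), ‖φ x‖ ^ 2) + ∫ x in Ioi ε, ‖φ x‖ ^ 2 with hX
  have hz0 : 0 < |z.im| := abs_pos.2 hz
  have he0 : 0 ≤ e := (norm_nonneg _).trans h1
  have p1 : 0 ≤ ∫ x in Iic (-ε), ‖φ x‖ ^ 2 := integral_nonneg fun x => by positivity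
  have p2 : 0 ≤ ∫ x in Ioi ε, ‖φ x‖ ^ 2 := integral_nonneg fun x => by positivity
  have sR : Ici ε ⊆ ({0}ᶜ : Set ℝ) := fun x hx => (hε.trans_le hx).ne'
  have sL : Iic (-ε) ⊆ ({0}ᶜ : Set ℝ) := fun x hx =>
    (lt_of_le_of_lt (mem_Iic.1 hx) (neg_neg_of_pos hε)).ne
  have mR : MemLp φ 2 (volume.restrict (Ioi ε)) := (h.mono (Ioi_subset_Ici_self.trans sR)).memLp
  have mL : MemLp φ 2 (volume.restrict (Iic (-ε))) := (h.mono sL).memLp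
  have bR : ‖φ₁ ε‖ ≤ 12 * (1 + ‖z‖) * √X := by
    have := (h.norm_le_right (f := 0) (z := z) (c := ε)
      (Icc_subset_Ici_self.trans sR) (by
        filter_upwards [he] with x hx hx'
        rw [hx (hx'.1.trans_le (le_abs_self x))]; simp)).2
    rw [lpNorm_zero, add_zero] at this
    refine this.trans ?_
    rw [mul_assoc]
    refine mul_le_mul_of_nonneg_left (mul_le_mul_of_nonneg_left ?_ (by positivity)) (by norm_num)
    refine (mR.lpNorm_mono_measure (Measure.restrict_mono Ioo_subset_Ioi_self le_rfl)).trans ?_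
    refine Real.le_sqrt_of_sq_le ?_
    rw [lpNorm_two_sq mR]; linarith
  have bL : ‖φ (-ε)‖ ≤ 12 * (1 + ‖z‖) * √X := by
    have := (h.norm_le_left (f := 0) (z := z) (c := -ε) MemLp.zero
      (Icc_subset_Iic_self.trans sL) (by
        filter_upwards [he] with x hx hx'
        rw [hx (by rw [lt_abs]; right; linarith [hx'.2])]; simp)).1
    rw [lpNorm_zero, add_zero] at this
    refine this.trans ?_
    rw [mul_assoc]
    refine mul_le_mul_of_nonneg_left (mul_le_mul_of_nonneg_left ?_ (by positivity)) (by norm_num)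
    refine (mL.lpNorm_mono_measure (Measure.restrict_mono
      (fun x hx => hx.2.le) le_rfl)).trans ?_
    refine Real.le_sqrt_of_sq_le ?_
    rw [lpNorm_two_sq mL]; linarith
  have pt (x : ℝ) (hx : φ₂ x = -z * φ x) : (φ₂ x * conj (φ x)).im = -z.im * ‖φ x‖ ^ 2 := by
    rw [hx, mul_assoc, Complex.mul_conj, Complex.normSq_eq_norm_sq, Complex.im_mul_ofReal,
      Complex.neg_im]
  have eR : -z.im * ∫ x in Ioi ε, ‖φ x‖ ^ 2 = -(φ₁ ε * conj (φ ε)).im := by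
    rw [← h.setIntegral_Ioi_im sR, ← integral_const_mul]
    refine setIntegral_congr_ae measurableSet_Ioi ?_
    filter_upwards [he] with x hx hx'
    exact (pt x (hx (lt_of_lt_of_le hx' (le_abs_self x)))).symm
  have eL : -z.im * ∫ x in Iic (-ε), ‖φ x‖ ^ 2 = (φ₁ (-ε) * conj (φ (-ε))).im := by
    rw [← h.setIntegral_Iic_im sL, ← integral_const_mul]
    refine setIntegral_congr_ae measurableSet_Iic ?_
    filter_upwards [he, compl_mem_ae_iff.2 (measure_singleton (-ε))] with x hx hne hx'
    refine (pt x (hx ?_)).symm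
    have : x < -ε := lt_of_le_of_ne hx' hne
    rw [lt_abs]; right; linarith
  -- Regrouping the boundary terms around the two defects: the cross terms θ φ₁(ε) φ̄(-ε) cancel,
  -- and the leftover κ|φ(-ε)|² is real.
  have e3 : z.im * X = ((θ * φ₁ ε - φ₁ (-ε) - κ * φ (-ε)) * conj (φ (-ε))).im +
      (φ₁ ε * conj (φ ε - θ * φ (-ε))).im := by
    have e4 : (θ * φ₁ ε - φ₁ (-ε) - κ * φ (-ε)) * conj (φ (-ε)) +
        φ₁ ε * conj (φ ε - θ * φ (-ε)) = φ₁ ε * conj (φ ε) - φ₁ (-ε) * conj (φ (-ε)) -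
        (κ * Complex.normSq (φ (-ε)) : ℝ) := by
      rw [map_sub, map_mul, Complex.conj_ofReal, Complex.ofReal_mul, ← Complex.mul_conj]
      ring
    rw [← Complex.add_im, e4, Complex.sub_im, Complex.sub_im, Complex.ofReal_im, hX]
    linarith
  -- Each defect is paired with a boundary value that is O(√X), so division by √X leaves a bound
  -- linear in e.
  have e5 : |z.im| * X ≤ (24 * (1 + ‖z‖) * e) * √X := by
    have hX0 : 0 ≤ X := add_nonneg p1 p2
    rw [← abs_of_nonneg hX0, ← abs_mul, e3, abs_of_nonneg hX0]
    refine (abs_add_le _ _).trans ?_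
    have a1 : |((θ * φ₁ ε - φ₁ (-ε) - κ * φ (-ε)) * conj (φ (-ε))).im| ≤
        e * (12 * (1 + ‖z‖) * √X) := by
      refine (Complex.abs_im_le_norm _).trans ?_
      rw [norm_mul, RCLike.norm_conj]
      exact mul_le_mul h2 bL (norm_nonneg _) he0
    have a2 : |(φ₁ ε * conj (φ ε - θ * φ (-ε))).im| ≤ e * (12 * (1 + ‖z‖) * √X) := by
      refine (Complex.abs_im_le_norm _).trans ?_
      rw [norm_mul, RCLike.norm_conj, mul_comm]
      exact mul_le_mul h1 bR (norm_nonneg _) he0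
    linarith
  rcases (Real.sqrt_nonneg X).eq_or_lt with h0 | h0
  · rw [← h0]; positivity
  · rw [div_mul_eq_mul_div, le_div_iff₀ hz0]
    refine le_of_mul_le_mul_right ?_ h0
    have : √X * √X = X := Real.mul_self_sqrt (add_nonneg p1 p2)
    calc √X * |z.im| * √X = |z.im| * (√X * √X) := by ring
      _ ≤ _ := by rw [this]; exact e5

end IsW22

/-! ### Norm resolvent convergence -/

theorem scaledPotential_eq_zero {Φ Ψ : ℝ → ℝ} (hΦ : IsPotential Φ) (hΨ : IsPotential Ψ)
    (α β : ℝ) {ε ν x : ℝ} (hε : 0 < ε) (hν : 0 < ν) (hνε : ν ≤ ε) (hx : ε < |x|) :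
    scaledPotential Φ Ψ α β ε ν x = 0 := by
  rw [scaledPotential, hΦ.rescale_eq_zero hε hx, hΨ.rescale_eq_zero hν (hνε.trans_lt hx)]
  simp

theorem scaledPotential_aemeasurable {Φ Ψ : ℝ → ℝ} (hΦ : IsPotential Φ) (hΨ : IsPotential Ψ)
    (α β : ℝ) {ε ν : ℝ} (hε : 0 < ε) (hν : 0 < ν) :
    AEMeasurable (scaledPotential Φ Ψ α β ε ν) volume :=
  (((hΦ.integrable.comp_div hε.ne').const_mul _).add
    ((hΨ.integrable.comp_div hν.ne').const_mul _)).aestronglyMeasurable.aemeasurable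

theorem scaledPotential_bounded {Φ Ψ : ℝ → ℝ} (hΦ : IsPotential Φ) (hΨ : IsPotential Ψ)
    (α β ε ν : ℝ) : ∃ M, ∀ x, |scaledPotential Φ Ψ α β ε ν x| ≤ M := by
  obtain ⟨M, -, hM⟩ := hΦ.exists_bound
  obtain ⟨N, -, hN⟩ := hΨ.exists_bound
  refine ⟨|α / ε ^ 2| * M + |β / ν| * N, fun x => (abs_add_le _ _).trans (add_le_add ?_ ?_)⟩
  · rw [abs_mul]; exact mul_le_mul_of_nonneg_left (hM _) (abs_nonneg _)
  · rw [abs_mul]; exact mul_le_mul_of_nonneg_left (hN _) (abs_nonneg _)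

/-- Substitution x = εt. The source becomes ε² f(εt), with L¹ norm ε ∫_{-ε}^{ε} |f| ≤ ε √(2ε) ‖f‖;
hence the size ε^{3/2} and, from √2 ≤ 2, the requirement 2‖f‖ ≤ B. -/
theorem isRescaledSolution_of_schrodinger {Φ Ψ : ℝ → ℝ} {α β : ℝ} {ψ ψ₁ ψ₂ f : ℝ → ℂ}
    (h : IsW22 univ ψ ψ₁ ψ₂) (hf : MemLp f 2 volume) {z : ℂ} {ε ν B : ℝ} (hε : 0 < ε)
    (he : ∀ᵐ x, ψ₂ x = scaledPotential Φ Ψ α β ε ν x * ψ x - z * ψ x - f x)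
    (hB : 2 * lpNorm f 2 volume ≤ B) (h0 : ‖ψ (-ε)‖ ≤ B) (h1 : ‖ψ₁ (-ε)‖ ≤ B) :
    IsRescaledSolution Φ Ψ α β z ε (ν / ε) B (fun t => ψ (ε * t)) (fun t => ε * ψ₁ (ε * t))
      (fun s => -(ε ^ 2 : ℝ) * f (ε * s)) := by
  have hc : Continuous ψ₁ := continuous_iff_continuousAt.2 fun x =>
    (h.continuousOn_one (subset_univ (uIcc (x - 1) (x + 1)))).continuousAt
      (by rw [uIcc_of_le (by linarith)]; exact Icc_mem_nhds (by linarith) (by linarith))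
  have hle : MemLp f 2 (volume.restrict (Ioc (-ε) ε)) := hf.mono_measure Measure.restrict_le_self
  have hfi : IntervalIntegrable f volume (ε * -1) (ε * 1) := by
    rw [mul_neg_one, mul_one]
    exact hle.intervalIntegrable_of_two (by linarith)
  refine ⟨(norm_nonneg _).trans h0, fun t => ?_, by fun_prop, ?_, fun t _ => ?_, ?_, ?_, ?_⟩
  · have := (h.hasDerivAt (ε * t) (mem_univ _)).scomp t ((hasDerivAt_id t).const_mul ε)
    simpa [Function.comp_def] using this
  · have := (hfi.comp_mul_left (c := ε)).const_mul (-(ε ^ 2 : ℝ) : ℂ)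
    rwa [mul_div_cancel_left₀ _ hε.ne', mul_div_cancel_left₀ _ hε.ne'] at this
  · have e1 : ψ₁ (ε * t) - ψ₁ (ε * -1) = ε * ∫ s in (-1 : ℝ)..t,
        (scaledPotential Φ Ψ α β ε ν (ε * s) * ψ (ε * s) - z * ψ (ε * s) - f (ε * s)) := by
      rw [h.sub_eq_integral _ _ (subset_univ _), intervalIntegral.integral_congr_ae
        (he.mono fun x hx _ => hx), ← intervalIntegral.smul_integral_comp_mul_left
        (fun x => scaledPotential Φ Ψ α β ε ν x * ψ x - z * ψ x - f x) ε, Complex.real_smul]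
    rw [← mul_sub, e1, ← mul_assoc, ← intervalIntegral.integral_const_mul]
    refine intervalIntegral.integral_congr fun s _ => ?_
    have e2 : (ε * s) / ν = s / (ν / ε) := by rw [div_div_eq_mul_div, mul_comm]
    simp only [scaledPotential, rescaledPerturbation, e2, mul_div_cancel_left₀ _ hε.ne']
    have hε' : (ε : ℂ) ≠ 0 := by exact_mod_cast hε.ne'
    push_cast
    rw [inv_div]
    field_simp
    ring
  · simpa using h0
  · rw [norm_mul, Complex.norm_real, Real.norm_of_nonneg hε.le]
    exact mul_le_mul_of_nonneg_left (by simpa using h1) hε.le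
  · have e1 : ∫ s in (-1 : ℝ)..1, ‖-(ε ^ 2 : ℝ) * f (ε * s)‖ = ε * ∫ x in -ε..ε, ‖f x‖ := by
      have := intervalIntegral.smul_integral_comp_mul_left (a := -1) (b := 1) (fun x => ‖f x‖) ε
      rw [mul_neg_one, mul_one, smul_eq_mul] at this
      rw [← this, ← mul_assoc, ← intervalIntegral.integral_const_mul]
      refine intervalIntegral.integral_congr fun s _ => ?_
      simp only [norm_mul, norm_neg, Complex.norm_real, Real.norm_of_nonneg (sq_nonneg ε)]
      ring
    rw [e1, mul_assoc]
    refine mul_le_mul_of_nonneg_left ?_ hε.le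
    refine (integral_norm_le_sqrt_mul_lpNorm (by linarith) hle).trans ?_
    have e2 : √(ε - -ε) ≤ 2 * √ε := by
      rw [show ε - -ε = 2 * ε by ring, Real.sqrt_mul (by norm_num)]
      refine mul_le_mul_of_nonneg_right ?_ (Real.sqrt_nonneg _)
      rw [Real.sqrt_le_left (by norm_num)]; norm_num
    calc √(ε - -ε) * lpNorm f 2 (volume.restrict (Ioc (-ε) ε))
        ≤ (2 * √ε) * lpNorm f 2 volume := mul_le_mul e2
          (hf.lpNorm_mono_measure Measure.restrict_le_self) lpNorm_nonneg (by positivity)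
      _ = √ε * (2 * lpNorm f 2 volume) := by ring
      _ ≤ _ := mul_le_mul_of_nonneg_left hB (Real.sqrt_nonneg _)

/-- The Cauchy data at `±ε` of an element of the domain of a point interaction. -/
theorem pointInteraction_transfer {θ γ : ℝ} (hθ : θ ≠ 0) {y y₁ y₂ : ℝ → ℂ}
    (h : IsW22 {0}ᶜ y y₁ y₂) {l m : ℂ} (l1 : Tendsto y (𝓝[<] 0) (𝓝 l))
    (l2 : Tendsto y₁ (𝓝[<] 0) (𝓝 m)) (l3 : Tendsto y (𝓝[>] 0) (𝓝 ((θ : ℂ) * l)))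
    (l4 : Tendsto y₁ (𝓝[>] 0) (𝓝 ((θ : ℂ)⁻¹ * m + (γ : ℂ) * l))) {ε B : ℝ} (hε : 0 < ε)
    (hε1 : ε ≤ 1) (hB : ∀ x ≠ 0, ‖y₁ x‖ ≤ B) (hB2 : lpNorm y₂ 2 volume ≤ B) :
    ‖y ε - θ * y (-ε)‖ ≤ (1 + |θ|) * ε * B ∧
      ‖θ * y₁ ε - y₁ (-ε) - (θ * γ : ℝ) * y (-ε)‖ ≤ (1 + |θ| + |θ * γ|) * √ε * B := by
  have hB0 : 0 ≤ B := lpNorm_nonneg.trans hB2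
  have hm : MemLp y₂ 2 volume := restrict_compl_zero ▸ h.memLp_two
  obtain ⟨r1, r2⟩ := h.norm_sub_limit_right (B := B) hε (fun x hx => hx.1.ne') l3 l4
    (fun x hx => hB x hx.1.ne') ((hm.lpNorm_mono_measure Measure.restrict_le_self).trans hB2)
  obtain ⟨s1, s2⟩ := h.norm_sub_limit_left (B := B) hε (fun x hx => hx.2.ne) l1 l2
    (fun x hx => hB x hx.2.ne) ((hm.lpNorm_mono_measure Measure.restrict_le_self).trans hB2)
  have hsqε : ε ≤ √ε := Real.le_sqrt_of_sq_le (by nlinarith)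
  have hθ' : (θ : ℂ) ≠ 0 := by exact_mod_cast hθ
  constructor
  · have e : y ε - θ * y (-ε) = (y ε - θ * l) - θ * (y (-ε) - l) := by ring
    rw [e]
    refine (norm_sub_le _ _).trans ?_
    rw [norm_mul, Complex.norm_real, Real.norm_eq_abs]
    linarith [mul_le_mul_of_nonneg_left s1 (abs_nonneg θ)]
  · have e : θ * y₁ ε - y₁ (-ε) - (θ * γ : ℝ) * y (-ε) =
        θ * (y₁ ε - ((θ : ℂ)⁻¹ * m + (γ : ℂ) * l)) - (y₁ (-ε) - m) -
          (θ * γ : ℝ) * (y (-ε) - l) := by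
      push_cast; field_simp; ring
    rw [e]
    refine (norm_sub_le _ _).trans ((add_le_add_left (norm_sub_le _ _) _).trans ?_)
    rw [norm_mul, norm_mul, Complex.norm_real, Complex.norm_real, Real.norm_eq_abs,
      Real.norm_eq_abs]
    have k1 := mul_le_mul_of_nonneg_left r2 (abs_nonneg θ)
    have k2 := mul_le_mul_of_nonneg_left (s1.trans (mul_le_mul_of_nonneg_right hsqε hB0))
      (abs_nonneg (θ * γ))
    linarith

/-- Splitting of an `L²` norm into the contributions inside and outside of `[-ε, ε]`. -/
theorem lpNorm_le_add_of_le {φ : ℝ → ℂ} (h : MemLp φ 2 volume) {ε A X : ℝ} (hε : 0 < ε)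
    (hA : 0 ≤ A) (hin : ∀ᵐ x, x ∈ Ioc (-ε) ε → ‖φ x‖ ≤ A)
    (hout : √((∫ x in Iic (-ε), ‖φ x‖ ^ 2) + ∫ x in Ioi ε, ‖φ x‖ ^ 2) ≤ X) :
    lpNorm φ 2 volume ≤ X + 2 * √ε * A := by
  have hX : 0 ≤ X := (Real.sqrt_nonneg _).trans hout
  have hi : Integrable fun x => ‖φ x‖ ^ 2 := h.integrable_norm_pow (by norm_num)
  have e1 := intervalIntegral.integral_Iic_add_Ioi (b := ε) (hi.integrableOn) (hi.integrableOn)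
  have e2 := intervalIntegral.integral_Iic_sub_Iic (a := -ε) (b := ε) hi.integrableOn
    hi.integrableOn
  have e3 : ∫ x in -ε..ε, ‖φ x‖ ^ 2 ≤ 2 * ε * A ^ 2 := by
    have := intervalIntegral.norm_integral_le_of_norm_le_const_ae (a := -ε) (b := ε) (C := A ^ 2)
      (f := fun x => ‖φ x‖ ^ 2) (by
        filter_upwards [hin] with x hx hx'
        rw [uIoc_of_le (by linarith)] at hx'
        rw [Real.norm_of_nonneg (by positivity)]
        exact pow_le_pow_left₀ (norm_nonneg _) (hx hx') 2)
    refine (le_abs_self _).trans (this.trans_eq ?_)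
    rw [abs_of_pos (by linarith)]; ring
  have e4 : (∫ x in Iic (-ε), ‖φ x‖ ^ 2) + ∫ x in Ioi ε, ‖φ x‖ ^ 2 ≤ X ^ 2 :=
    (Real.sqrt_le_left hX).1 hout
  have e5 : lpNorm φ 2 volume ^ 2 ≤ (X + 2 * √ε * A) ^ 2 := by
    rw [lpNorm_two_sq h]
    have := Real.sq_sqrt hε.le
    have p : 0 ≤ X * (√ε * A) := by positivity
    have p2 : 0 ≤ ε * A ^ 2 := by positivity
    calc ∫ x, ‖φ x‖ ^ 2 ≤ X ^ 2 + 2 * ε * A ^ 2 := by linarith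
      _ ≤ X ^ 2 + 4 * (X * (√ε * A)) + 4 * (√ε ^ 2) * A ^ 2 := by rw [this]; linarith
      _ = _ := by ring
  exact le_of_sq_le_sq e5 (by positivity)

/-- The estimate is stated for elements of the two graphs with a common f, so that it becomes an
operator norm bound with constants independent of f, ε and ν. -/
theorem resolvent_difference_le {Φ Ψ : ℝ → ℝ} (hΦ : IsPotential Φ) (hΨ : IsPotential Ψ)
    (α β : ℝ) {u : ℝ → ℝ} (hu : IsNormalizedHalfBoundState Φ α u) {z : ℂ} (hz : z.im ≠ 0) :
    ∃ C > 0, ∃ δ > 0, ∀ ε ν : ℝ, 0 < ε → ε < δ → 0 < ν → ν / ε < δ → ∀ f p y : L2R,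
      (p, f + z • p) ∈ schrodingerGraph (scaledPotential Φ Ψ α β ε ν) →
      (y, f + z • y) ∈ pointInteractionGraph (theta u) (β * mu Ψ u) →
      ‖p - y‖ ≤ C * (√ε + ν / ε) * ‖f‖ := by
  have hθ : theta u ≠ 0 := by rw [hu.theta_eq]; exact hu.1.apply_one_ne_zero hΦ
  have hz0 : 0 < |z.im| := abs_pos.2 hz
  obtain ⟨C, hC, δ, hδ, hδ1, htr⟩ := IsRescaledSolution.transfer hΦ hΨ α β hu z
  set θ := theta u with hθdef
  set κ := β * (u 0 ^ 2 * ∫ t, Ψ t) with hκ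
  -- The factor θ⁻¹ in μ is there to make κ equal to the coefficient produced by the Wronskian.
  have hκθ : θ * (β * mu Ψ u) = κ := by rw [mu, ← hθdef, hκ]; field_simp
  -- K‖f‖ is one common bound for the boundary values of ψ, the values of χ and χ₁ off 0, ‖χ₂‖ and
  -- 2‖f‖. Its main part is the pointwise estimate combined with the L² bound |Im z|⁻¹‖f‖.
  set K := 12 * ((1 + ‖z‖) * |z.im|⁻¹ + 1) + 2 with hK
  have hK0 : 0 < K := by positivity
  set D := 24 * (1 + ‖z‖) / |z.im| with hD
  have hD0 : 0 ≤ D := by positivity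
  refine ⟨D * ((C + 1 + |θ| + |κ|) * K) + 2 * ((C + 1) * K), by positivity, δ, hδ, ?_⟩
  intro ε ν hε hεδ hν hνδ f p y hp hy
  have hε1 : ε ≤ 1 := (hεδ.trans_le hδ1).le
  have hη0 : 0 < ν / ε := div_pos hν hε
  have hη1 : ν / ε < 1 := hνδ.trans_le hδ1
  have hνε : ν ≤ ε := by rw [div_lt_one hε] at hη1; exact hη1.le
  have hpn : ‖p‖ ≤ |z.im|⁻¹ * ‖f‖ := by
    have := abs_im_mul_norm_le (schrodingerGraph_im_inner hp) z
    simp only [add_sub_cancel_right] at this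
    rwa [inv_mul_eq_div, le_div_iff₀ hz0, mul_comm]
  have hyn : ‖y‖ ≤ |z.im|⁻¹ * ‖f‖ := by
    have := abs_im_mul_norm_le (pointInteractionGraph_im_inner hθ hy) z
    simp only [add_sub_cancel_right] at this
    rwa [inv_mul_eq_div, le_div_iff₀ hz0, mul_comm]
  obtain ⟨ψ, ψ₁, ψ₂, h, hp1, hp2⟩ := hp
  obtain ⟨χ, χ₁, χ₂, k, ⟨l, m, l1, l2, l3, l4⟩, hy1, hy2⟩ := hy
  simp only at hp1 hp2 hy1 hy2
  have hf := Lp.memLp f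
  set F := ‖f‖ with hF
  have hF0 : 0 ≤ F := norm_nonneg f
  have hfF : lpNorm f 2 volume = F := (L2R.norm_eq_lpNorm EventuallyEq.rfl).symm
  have hψ2 : ∀ᵐ x, ψ₂ x = scaledPotential Φ Ψ α β ε ν x * ψ x - z * ψ x - f x := by
    filter_upwards [hp1, hp2, Lp.coeFn_add f (z • p), Lp.coeFn_smul z p] with x a b c d
    rw [c, Pi.add_apply, d, Pi.smul_apply, a, smul_eq_mul] at b
    linear_combination b
  have hχ2 : ∀ᵐ x, χ₂ x = -z * χ x - f x := by
    filter_upwards [hy1, hy2, Lp.coeFn_add f (z • y), Lp.coeFn_smul z y] with x a b c d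
    rw [c, Pi.add_apply, d, Pi.smul_apply, a, smul_eq_mul] at b
    linear_combination b
  have mψ : MemLp ψ 2 volume := by simpa using h.memLp
  have mχ : MemLp χ 2 volume := restrict_compl_zero ▸ k.memLp
  have nψ : lpNorm ψ 2 volume ≤ |z.im|⁻¹ * F := by rwa [← L2R.norm_eq_lpNorm hp1]
  have nχ : lpNorm χ 2 volume ≤ |z.im|⁻¹ * F := by rwa [← L2R.norm_eq_lpNorm hy1]
  have bound {g : ℝ → ℂ} (mg : MemLp g 2 volume) (ng : lpNorm g 2 volume ≤ |z.im|⁻¹ * F)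
      (s : Set ℝ) : 12 * ((1 + ‖z‖) * lpNorm g 2 (volume.restrict s) +
        lpNorm f 2 (volume.restrict s)) ≤ K * F := by
    have h1 := (mg.lpNorm_mono_measure (Measure.restrict_le_self (s := s))).trans ng
    have h2 := (hf.lpNorm_mono_measure (Measure.restrict_le_self (s := s))).trans_eq hfF
    have h3 := mul_le_mul_of_nonneg_left h1 (by positivity : 0 ≤ 1 + ‖z‖)
    calc _ ≤ 12 * ((1 + ‖z‖) * (|z.im|⁻¹ * F) + F) := by linarith
      _ ≤ 12 * ((1 + ‖z‖) * (|z.im|⁻¹ * F) + F) + 2 * F := by linarith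
      _ = K * F := by rw [hK]; ring
  have hχb (x : ℝ) (hx : x ≠ 0) : ‖χ x‖ ≤ K * F ∧ ‖χ₁ x‖ ≤ K * F := by
    rcases hx.lt_or_gt with h0 | h0
    · have := k.norm_le_left (z := z) (c := x) hf (fun t ht => (ht.2.trans_lt h0).ne)
        (hχ2.mono fun t ht _ => ht)
      exact ⟨this.1.trans (bound mχ nχ _), this.2.trans (bound mχ nχ _)⟩
    · have := k.norm_le_right (z := z) (c := x) (fun t ht => (h0.trans_le ht.1).ne')
        (hχ2.mono fun t ht _ => ht)
      exact ⟨this.1.trans (bound mχ nχ _), this.2.trans (bound mχ nχ _)⟩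
  -- The bound must be uniform in ε and ν, so it uses the interval to the left of -ε, where the
  -- potential vanishes.
  have hψb : ‖ψ (-ε)‖ ≤ K * F ∧ ‖ψ₁ (-ε)‖ ≤ K * F := by
    have := h.norm_le_left (z := z) (c := -ε) hf (subset_univ _) (by
      filter_upwards [hψ2] with t ht ht'
      rw [ht, scaledPotential_eq_zero hΦ hΨ α β hε hν hνε
        (by rw [lt_abs]; right; linarith [ht'.2])]
      push_cast; ring)
    exact ⟨this.1.trans (bound mψ nψ _), this.2.trans (bound mψ nψ _)⟩
  have hχ2n : lpNorm χ₂ 2 volume ≤ K * F := by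
    have := k.lpNorm_two_le (z := z) (f := f) (s := {0}ᶜ) subset_rfl (ae_restrict_of_ae hχ2)
    rw [restrict_compl_zero, hfF] at this
    have h3 := mul_le_mul_of_nonneg_left nχ (norm_nonneg z)
    have h4 : 0 ≤ |z.im|⁻¹ * F := by positivity
    have h5 : 0 ≤ ‖z‖ * (|z.im|⁻¹ * F) := by positivity
    have h6 : K * F = 12 * (|z.im|⁻¹ * F) + 12 * (‖z‖ * (|z.im|⁻¹ * F)) + 14 * F := by
      rw [hK]; ring
    linarith
  have hKF : 2 * lpNorm f 2 volume ≤ K * F := by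
    rw [hfF]
    refine mul_le_mul_of_nonneg_right ?_ hF0
    have : 0 ≤ (1 + ‖z‖) * |z.im|⁻¹ := by positivity
    linarith
  have hsol := isRescaledSolution_of_schrodinger h hf hε hψ2 hKF hψb.1 hψb.2
  obtain ⟨t0, t1, t2⟩ := htr ε (ν / ε) (K * F) hε hεδ hη0 hη1 _ _ _ hsol
  obtain ⟨s1, s2⟩ := pointInteraction_transfer hθ k l1 l2 l3 l4 hε hε1
    (fun x hx => (hχb x hx).2) hχ2n
  rw [hκθ] at s2
  simp only [mul_one, mul_neg] at t1 t2
  -- Since v' = ε ψ', one factor ε cancels. This is why the rescaled derivative had to be known to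
  -- order ε(√ε + η).
  have t2' : ‖θ * ψ₁ ε - ψ₁ (-ε) - κ * ψ (-ε)‖ ≤ C * (√ε + ν / ε) * (K * F) := by
    have e : θ * (ε * ψ₁ ε) - ε * ψ₁ (-ε) - ε * (κ : ℂ) * ψ (-ε) =
        ε * (θ * ψ₁ ε - ψ₁ (-ε) - κ * ψ (-ε)) := by ring
    rw [e, norm_mul, Complex.norm_real, Real.norm_of_nonneg hε.le] at t2
    refine le_of_mul_le_mul_left (t2.trans_eq ?_) hε
    ring
  have hsqε : ε ≤ √ε := Real.le_sqrt_of_sq_le (by nlinarith)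
  have hsη : √ε ≤ √ε + ν / ε := by linarith
  have hKF0 : 0 ≤ K * F := by positivity
  set e := (C + 1 + |θ| + |κ|) * (√ε + ν / ε) * (K * F) with he
  have hd := (h.mono (subset_univ _)).sub k
  have d1 : ‖(ψ - χ) ε - θ * (ψ - χ) (-ε)‖ ≤ e := by
    have e1 : (ψ - χ) ε - θ * (ψ - χ) (-ε) = (ψ ε - θ * ψ (-ε)) - (χ ε - θ * χ (-ε)) := by
      simp only [Pi.sub_apply]; ring
    rw [e1]
    refine (norm_sub_le _ _).trans ((add_le_add t1 s1).trans ?_)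
    calc C * ε * (K * F) + (1 + |θ|) * ε * (K * F) = (C + 1 + |θ|) * ε * (K * F) := by ring
      _ ≤ (C + 1 + |θ| + |κ|) * (√ε + ν / ε) * (K * F) :=
        mul_le_mul_of_nonneg_right (mul_le_mul (by linarith [abs_nonneg κ])
          (hsqε.trans hsη) hε.le (by positivity)) hKF0
  have d2 : ‖θ * (ψ₁ - χ₁) ε - (ψ₁ - χ₁) (-ε) - κ * (ψ - χ) (-ε)‖ ≤ e := by
    have e1 : θ * (ψ₁ - χ₁) ε - (ψ₁ - χ₁) (-ε) - κ * (ψ - χ) (-ε) =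
        (θ * ψ₁ ε - ψ₁ (-ε) - κ * ψ (-ε)) - (θ * χ₁ ε - χ₁ (-ε) - κ * χ (-ε)) := by
      simp only [Pi.sub_apply]; ring
    rw [e1]
    refine (norm_sub_le _ _).trans ((add_le_add t2' s2).trans ?_)
    calc C * (√ε + ν / ε) * (K * F) + (1 + |θ| + |κ|) * √ε * (K * F)
        ≤ C * (√ε + ν / ε) * (K * F) + (1 + |θ| + |κ|) * (√ε + ν / ε) * (K * F) := by gcongr
      _ = e := by rw [he]; ring
  have hout := hd.exterior_le (θ := θ) (κ := κ) hz hε (by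
    filter_upwards [hψ2, hχ2] with x a b hx
    rw [Pi.sub_apply, Pi.sub_apply, a, b, scaledPotential_eq_zero hΦ hΨ α β hε hν hνε hx]
    push_cast; ring) d1 d2
  have hin : ∀ᵐ x, x ∈ Ioc (-ε) ε → ‖(ψ - χ) x‖ ≤ (C + 1) * (K * F) := by
    filter_upwards [compl_mem_ae_iff.2 (measure_singleton (0 : ℝ))] with x hx hx'
    refine (norm_sub_le _ _).trans ?_
    have h1 := t0 (x / ε) ⟨by rw [le_div_iff₀ hε]; linarith [hx'.1],
      by rw [div_le_one hε]; exact hx'.2⟩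
    rw [mul_div_cancel₀ _ hε.ne'] at h1
    linarith [(hχb x hx).1]
  have hfin := lpNorm_le_add_of_le (mψ.sub mχ) hε (by positivity) hin hout
  have hpy : ‖p - y‖ = lpNorm (ψ - χ) 2 volume := by
    refine L2R.norm_eq_lpNorm ?_
    filter_upwards [Lp.coeFn_sub p y, hp1, hy1] with x a b c
    rw [a, Pi.sub_apply, b, c, Pi.sub_apply]
  rw [hpy]
  refine hfin.trans ?_
  have : 2 * √ε * ((C + 1) * (K * F)) ≤ 2 * (√ε + ν / ε) * ((C + 1) * (K * F)) := by gcongr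
  calc D * e + 2 * √ε * ((C + 1) * (K * F)) ≤
      D * e + 2 * (√ε + ν / ε) * ((C + 1) * (K * F)) := by linarith
    _ = _ := by rw [he]; ring

theorem mainTheorem2 (Φ Ψ : ℝ → ℝ) (hΦ : IsPotential Φ) (hΨ : IsPotential Ψ) (α β : ℝ)
    (hα : α ∈ resonantSet Φ) :
    (∃! u : ℝ → ℝ, IsNormalizedHalfBoundState Φ α u) ∧
    ∀ u : ℝ → ℝ, IsNormalizedHalfBoundState Φ α u →
      theta u ≠ 0 ∧
      ∀ z : ℂ, z.im ≠ 0 →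
        ∃ (R : ℝ → ℝ → L2R →L[ℂ] L2R) (R₀ : L2R →L[ℂ] L2R),
          (∀ ε ν : ℝ, 0 < ε → 0 < ν →
            IsResolvent (schrodinger (scaledPotential Φ Ψ α β ε ν)) z (R ε ν)) ∧
          IsResolvent (pointInteraction (theta u) (β * mu Ψ u)) z R₀ ∧
          Tendsto (fun p : ℝ × ℝ => ‖R p.1 p.2 - R₀‖) fastContraction (𝓝 0) ∧
          ∃ C > 0, ∃ δ > 0, ∀ ε ν : ℝ, 0 < ε → ε < δ → 0 < ν → ν / ε < δ →
            ‖R ε ν - R₀‖ ≤ C * (√ε + ν / ε) := by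
  refine ⟨existsUnique_normalizedHalfBoundState hΦ hα, fun u hu => ?_⟩
  have hθ : theta u ≠ 0 := by rw [hu.theta_eq]; exact hu.1.apply_one_ne_zero hΦ
  refine ⟨hθ, fun z hz => ?_⟩
  obtain ⟨R₀, hR₀, gR₀⟩ := pointInteraction_exists_isResolvent (γ₂ := β * mu Ψ u) hθ hz
  have hex (ε ν : ℝ) : ∃ R : L2R →L[ℂ] L2R, 0 < ε → 0 < ν →
      IsResolvent (schrodinger (scaledPotential Φ Ψ α β ε ν)) z R ∧
        ∀ f, (R f, f + z • R f) ∈ schrodingerGraph (scaledPotential Φ Ψ α β ε ν) := by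
    by_cases hpos : 0 < ε ∧ 0 < ν
    · obtain ⟨M, hM⟩ := scaledPotential_bounded hΦ hΨ α β ε ν
      obtain ⟨R, hR⟩ := schrodinger_exists_isResolvent hz (schrodinger_surjective hz
        (scaledPotential_aemeasurable hΦ hΨ α β hpos.1 hpos.2) hM)
      exact ⟨R, fun _ _ => hR⟩
    -- The value 0 for nonpositive parameters is arbitrary.
    · exact ⟨0, fun h1 h2 => absurd ⟨h1, h2⟩ hpos⟩
  choose R hR using hex
  obtain ⟨C, hC, δ, hδ, hest⟩ := resolvent_difference_le hΦ hΨ α β hu hz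
  have hmain : ∀ ε ν : ℝ, 0 < ε → ε < δ → 0 < ν → ν / ε < δ →
      ‖R ε ν - R₀‖ ≤ C * (√ε + ν / ε) := fun ε ν hε hεδ hν hνδ => by
    have : 0 < ν / ε := div_pos hν hε
    exact ContinuousLinearMap.opNorm_le_bound _ (by positivity) fun f =>
      hest ε ν hε hεδ hν hνδ f _ _ ((hR ε ν hε hν).2 f) (gR₀ f)
  refine ⟨R, R₀, fun ε ν hε hν => (hR ε ν hε hν).1, hR₀, ?_, C, hC, δ, hδ, hmain⟩
  have hcom : Tendsto (fun p : ℝ × ℝ => (p.1, p.2 / p.1)) fastContraction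
      (𝓝[>] 0 ×ˢ 𝓝[>] 0) := tendsto_comap
  have hbd : Tendsto (fun q : ℝ × ℝ => C * (√q.1 + q.2)) (𝓝[>] 0 ×ˢ 𝓝[>] 0) (𝓝 0) := by
    have hc : Continuous fun q : ℝ × ℝ => C * (√q.1 + q.2) := by fun_prop
    have := hc.tendsto (0, 0)
    rw [nhds_prod_eq] at this
    simpa using this.mono_left (prod_mono nhdsWithin_le_nhds nhdsWithin_le_nhds)
  refine squeeze_zero' (Eventually.of_forall fun p => norm_nonneg _) ?_ (hbd.comp hcom)
  -- The filter controls only ε and the quotient ν/ε; positivity of ν is recovered from these two.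
  have hmem : Ioo 0 δ ×ˢ Ioo 0 δ ∈ 𝓝[>] (0 : ℝ) ×ˢ 𝓝[>] (0 : ℝ) :=
    prod_mem_prod (Ioo_mem_nhdsGT hδ) (Ioo_mem_nhdsGT hδ)
  filter_upwards [hcom hmem] with p hp
  exact hmain p.1 p.2 hp.1.1 hp.1.2 ((div_pos_iff_of_pos_right hp.1.1).1 hp.2.1) hp.2.2
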